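/- **Notation.** Fix $n,N,C\ge 0$. Write $[n]=\{1,\dots,n\}$ and $[n]_\infty=[n]\cup\{\infty\}$. For a set $J\subseteq[n]_\infty$ let $\pm J$ consist of $k$ and $-k$ for $k\in J$, let $\delta(k)=-k$, and for a permutation $\pi$ let $\#(\pi)$ be its number of orbits (fixed points included). Permutations are composed right to left. $\mathrm{PM}(J)$ is the set of permutations $\pi$ of $\pm J$ with $\delta\pi\delta=\pi^{-1}$ such that $k$ and $-k$ are never in the same cycle; the cycles of such a $\pi$ come in pairs, and $\mathrm{FD}(\pi)$ is the set of elements of those cycles in which $\infty$ (if $\pm\infty$ appears), or otherwise the integer of smallest absolute value, appears with positive sign. For a permutation $\varphi$ of $J$ let $\varphi_+$ be $\varphi$ acting on the positive elements of $\pm J$ (and trivially on the negative ones) and $\varphi_-=\delta\varphi_+\delta$. For $\alpha\in\mathrm{PM}(J)$ put $K(\varphi,\alpha)=\varphi_+^{-1}\alpha^{-1}\varphi_-\in \mathrm{PM}(J)$ and $$\chi(\varphi,\alpha)=\#(\varphi_+\varphi_-^{-1})/2+\#(\alpha)/2+\#(K(\varphi,\alpha))/2-|J|.$$ For $\varepsilon:[n]\to\{1,-1\}$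 let $\delta_\varepsilon(k)=\varepsilon(|k|)k$, with $\varepsilon(\infty)=1$. A quaternion $a+bi+cj+dk$ is identified with the complex matrix $\begin{pmatrix}a+bi&c+di\\-c+di&a-bi\end{pmatrix}$, whose rows and columns are indexed by $1,-1$. The entry of a matrix $A\in M_{N\times N}(\mathbb H)$ with matrix indices $i,j\in[N]$ and quaternion indices $\eta,\theta\in\{1,-1\}$ is $A_{i,j;\eta,\theta}$. Write $A^{(1)}=A$ and $A^{(-1)}=A^*$ (conjugate transpose); for a list $A_1,\dots,A_n$ and $k\in[n]$ write $A^{(k)}=A_k$ and $A^{(-k)}=A_k^*$. For $\pi,\rho\in\mathrm{PM}([n]_\infty)$, $a,b\in[N]$, $c,d\in\{1,-1\}$, let $$[\mathrm{Re}_{\mathrm{FD}(\pi)}\mathrm{tr}_{\mathrm{FD}(\rho)}(A_1,\dots,A_n)]_{a,b;c,d}=2^{-(\#(\pi)/2-1)}N^{-(\#(\rho)/2-1)}\sum_{i,h}\ \prod_{k\in\mathrm{FD}(\pi)\setminus\{\infty\}}A^{(k)}_{i_k,i_{\rho(k)};h_k,h_{\pi(k)}},$$ where the sum is over all $i:\pm[n]_\infty\to[N]$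 with $i_{-k}=i_{\rho(k)}$ for all $k$, $i_\infty=a$, $i_{\rho(\infty)}=b$, and all $h:\mathrm{FD}(\pi)\to\{1,-1\}$ with $h_\infty=c$, $h_{\pi(\infty)}=d$. (The indices at $\infty$ are uncontracted, so that the expression is matrix- and quaternion-valued.) For permutations $\varphi,\varphi'$ of $[n]_\infty$, $\mathrm{Re}_{\varphi}\mathrm{tr}_{\varphi'}$ means the case $\pi=\varphi_+\varphi_-^{-1}$, $\rho=\varphi'_+(\varphi'_-)^{-1}$, for which $\mathrm{FD}(\pi)=\mathrm{FD}(\rho)=[n]_\infty$ and $\pi,\rho$ restrict to $\varphi,\varphi'$ there. **Proposition.** On a probability space, let $X_{c,k}$ ($c\in[C]$, $k\in[n]$) be random $N\times N$ quaternionic matrices such that the $C$ families $(X_{c,1},\dots,X_{c,n})$ are independent, and suppose that there are functions $f_c:\mathrm{PM}(I)\to\mathbb C$ (for every $c\in[C]$ and $I\subseteq[n]$) such that, for all $c$, all $I\subseteq[n]$, all $\iota:\pm I\to[N]$ and all $\eta:\pm I\to\{1,-1\}$, the following moment is finite and $$\mathbb E\Big(\prod_{k\in I}X^{(c,k)}_{\iota_k,\iota_{-k};\eta_k,\eta_{-k}}\Big)=\sum_{\substack{\alpha\in\mathrm{PM}(I)\\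 \iota=\iota\circ\delta\alpha\\ \mathrm{sgn}\cdot\eta=(\mathrm{sgn}\circ\alpha)\cdot(\eta\circ\delta\alpha)}}\Big[\prod_{\substack{k\in I\\-k\in\mathrm{FD}(\alpha)}}\eta_k\eta_{-k}\Big](2N)^{\#(\alpha)/2-|I|}f_c(\alpha).$$ Let $w:[n]\to[C]$ and $X_k=X_{w(k),k}$. Let $Y_1,\dots,Y_n$ be random $N\times N$ quaternionic matrices, jointly independent from $(X_1,\dots,X_n)$, for which every product of one entry of each of $Y_1,\dots,Y_n$ is integrable. Let $\varphi_{\mathrm{Re}},\varphi_{\mathrm{tr}}\in S([n]_\infty)$ and $\varepsilon:[n]\to\{1,-1\}$. Then every entry of $\mathrm{Re}_{\varphi_{\mathrm{Re}}}\mathrm{tr}_{\varphi_{\mathrm{tr}}}(X_1^{(\varepsilon(1))}Y_1,\dots,X_n^{(\varepsilon(n))}Y_n)$ is integrable and, entry by entry (for all values of the uncontracted indices $a,b;c,d$), $$\mathbb E\big(\mathrm{Re}_{\varphi_{\mathrm{Re}}}\mathrm{tr}_{\varphi_{\mathrm{tr}}}(X_1^{(\varepsilon(1))}Y_1,\dots,X_n^{(\varepsilon(n))}Y_n)\big)=\sum_{\substack{\alpha=\alpha_1\cdots\alpha_C\\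 \alpha_c\in\mathrm{PM}(w^{-1}(c))}}(-2)^{\chi(\varphi_{\mathrm{Re}},\delta_\varepsilon\alpha\delta_\varepsilon)-2\#(\varphi_{\mathrm{Re}})}N^{\chi(\varphi_{\mathrm{tr}},\delta_\varepsilon\alpha\delta_\varepsilon)-2\#(\varphi_{\mathrm{tr}})}$$ $$\times f_1(\alpha_1)\cdots f_C(\alpha_C)\ \mathbb E\big(\mathrm{Re}_{\mathrm{FD}(K(\varphi_{\mathrm{Re}},\delta_\varepsilon\alpha\delta_\varepsilon)^{-1})}\mathrm{tr}_{\mathrm{FD}(K(\varphi_{\mathrm{tr}},\delta_\varepsilon\alpha\delta_\varepsilon)^{-1})}(Y_1,\dots,Y_n)\big),$$ where $\alpha$ is taken to act trivially on $\pm\infty$, and its cycles are counted as a permutation of $\pm[n]_\infty$ (so $J=[n]_\infty$, $|J|=n+1$ in $\chi$). -/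

import Mathlib

open MeasureTheory ProbabilityTheory Equiv
open scoped BigOperators

noncomputable section

namespace QuatExpansion

/-! ### Signed index sets and permutations -/

/-- The set `±J`: two signed copies of an index set `J`; `(k, 1)` is `k` and `(k, -1)` is `-k`. -/
abbrev Signed (J : Type) : Type := J × ℤˣ

/-- The set `[n]_∞`. The added least element `⊥` is the point at infinity; it is placed first
because it takes precedence over all the integers in the choice made in `FD` below. -/
abbrev PtInf (n : ℕ) : Type := WithBot (Fin n)

/-- The point `+∞` of `±[n]_∞`. -/
abbrev infPt (n : ℕ) : Signed (PtInf n) := (⊥, 1)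

/-- `δ_ε : k ↦ ε(|k|) k`. -/
def flip {J : Type} (ε : J → ℤˣ) : Perm (Signed J) where
  toFun k := (k.1, ε k.1 * k.2)
  invFun k := (k.1, ε k.1 * k.2)
  left_inv k := by simp [← mul_assoc]
  right_inv k := by simp [← mul_assoc]

/-- `δ : k ↦ -k`. -/
def delta (J : Type) : Perm (Signed J) := flip fun _ => -1

/-- `#(π)`, the number of orbits of `π` (fixed points included). -/
def numCycles {S : Type} (π : Perm S) : ℕ := Nat.card (Quotient (Perm.SameCycle.setoid π))

/-- `π ∈ PM(J)`: `δ π δ = π⁻¹`, and `k` and `-k` are never in the same cycle. -/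
def IsPM {J : Type} (π : Perm (Signed J)) : Prop :=
  delta J * π * delta J = π⁻¹ ∧ ∀ k, ¬ π.SameCycle k (delta J k)

/-- The set `PM(J)`. -/
abbrev PM (J : Type) : Type := {π : Perm (Signed J) // IsPM π}

instance {J : Type} [Finite J] : Fintype (PM J) := Fintype.ofFinite _

open Classical in
/-- `FD(π)`: the elements of those cycles of `π` in which the index of least absolute value
appears with a positive sign. -/
def FD {J : Type} [Fintype J] [LinearOrder J] (π : Perm (Signed J)) : Finset (Signed J) :=
  Finset.univ.filter fun k =>
    ∃ m : J, π.SameCycle k (m, 1) ∧ ∀ l : Signed J, π.SameCycle k l → m ≤ l.1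

theorem apply_mem_FD {J : Type} [Fintype J] [LinearOrder J] (π : Perm (Signed J))
    {k : Signed J} (hk : k ∈ FD π) : π k ∈ FD π := by
  simp only [FD, Finset.mem_filter, Finset.mem_univ, true_and] at hk ⊢
  simpa only [Perm.sameCycle_apply_left] using hk

theorem infPt_mem_FD {n : ℕ} (π : Perm (Signed (PtInf n))) : infPt n ∈ FD π := by
  simp only [FD, Finset.mem_filter, Finset.mem_univ, true_and]
  exact ⟨⊥, Perm.SameCycle.refl _ _, fun l _ => bot_le⟩

/-- `π` as a permutation of `FD(π)`. -/
def nextFD {J : Type} [Fintype J] [LinearOrder J] (π : Perm (Signed J)) (k : FD π) : FD π :=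
  ⟨π k, apply_mem_FD π k.2⟩

/-- `+∞` as an element of `FD(π)`. -/
def infFD {n : ℕ} (π : Perm (Signed (PtInf n))) : FD π := ⟨infPt n, infPt_mem_FD π⟩

/-- `φ₊`: a permutation `φ` of `J` acting on the positive copy of `J` in `±J`. -/
def plus {J : Type} (φ : Perm J) : Perm (Signed J) where
  toFun k := if k.2 = 1 then (φ k.1, k.2) else k
  invFun k := if k.2 = 1 then (φ⁻¹ k.1, k.2) else k
  left_inv k := by by_cases h : k.2 = 1 <;> simp [h, Prod.ext_iff]
  right_inv k := by by_cases h : k.2 = 1 <;> simp [h, Prod.ext_iff]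

/-- `φ₋ = δ φ₊ δ`. -/
def minus {J : Type} (φ : Perm J) : Perm (Signed J) := delta J * plus φ * delta J

/-- `φ₊ φ₋⁻¹`, the element of `PM(J)` whose `FD` is `φ`. -/
def double {J : Type} (φ : Perm J) : Perm (Signed J) := plus φ * (minus φ)⁻¹

/-- `K(φ₊, α) = φ₊⁻¹ α⁻¹ φ₋`. -/
def K {J : Type} (φ : Perm J) (α : Perm (Signed J)) : Perm (Signed J) :=
  (plus φ)⁻¹ * α⁻¹ * minus φ

/-- The Euler characteristic `#(φ₊φ₋⁻¹)/2 + #(α)/2 + #(K(φ₊, α))/2 - |J|`. The cycles of an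
element of `PM(J)` come in pairs, so for `α ∈ PM(J)` the divisions are exact. -/
def chi {J : Type} [Fintype J] (φ : Perm J) (α : Perm (Signed J)) : ℤ :=
  ((numCycles (double φ) / 2 : ℕ) : ℤ) + ((numCycles α / 2 : ℕ) : ℤ)
    + ((numCycles (K φ α) / 2 : ℕ) : ℤ) - (Fintype.card J : ℤ)

/-! ### Quaternionic matrices -/

/-- The entries of the representation of `a + bi + cj + dk` as the complex matrix with rows
`(a + bi, c + di)` and `(-c + di, a - bi)`, rows and columns being indexed by `1, -1`. -/
def quatEntry (q : Quaternion ℝ) (η θ : ℤˣ) : ℂ :=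
  if η = 1 then
    if θ = 1 then ⟨q.re, q.imI⟩ else ⟨q.imJ, q.imK⟩
  else
    if θ = 1 then ⟨-q.imJ, q.imK⟩ else ⟨q.re, -q.imI⟩

/-- `M_{N×N}(ℍ)`. -/
abbrev QMat (N : ℕ) : Type := Matrix (Fin N) (Fin N) (Quaternion ℝ)

/-- The entry `A_{i,j;η,θ}`. -/
def entry {N : ℕ} (A : QMat N) (i j : Fin N) (η θ : ℤˣ) : ℂ := quatEntry (A i j) η θ

/-- `A^{(s)}`: `A` for `s = 1` and the conjugate transpose `A*` for `s = -1`. -/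
def starPow {N : ℕ} (A : QMat N) (s : ℤˣ) : QMat N := if s = 1 then A else A.conjTranspose

/-- `A^{(k)}` for `k ∈ ±[n]_∞`. There is no matrix at `±∞`: that value is never used. -/
def signedMat {n N : ℕ} (A : Fin n → QMat N) : Signed (PtInf n) → QMat N
  | (none, _) => 0
  | (some j, s) => starPow (A j) s

open Classical in
/-- The entry `[Re_π tr_ρ (A₁, …, A_n)]_{a, b; c, d}`, where `a = i_∞`, `b = i_{ρ(∞)}`, `c = h_∞`,
`d = h_{π(∞)}` are the uncontracted indices, for `π, ρ ∈ PM([n]_∞)`: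
`2^{-(#(FD(π)) - 1)} N^{-(#(FD(ρ)) - 1)} ∑_{i, h} ∏_{k ∈ FD(π) \ {∞}} A^{(k)}_{i_k, i_{ρ(k)}; h_k, h_{π(k)}}`.
The index `i_k` is the left matrix index of `A^{(k)}`. As passing from `A^{(k)}` to `A^{(-k)}`
exchanges the two matrix indices, the right matrix index `i_{ρ(k)}` of `A^{(k)}` is also `i_{-k}`;
the sum is over the labellings `i` of `±[n]_∞` that respect this, so that `i_{ρ(k)}` makes sense
also when `ρ(k) ∉ FD(π)`. If `ρ` (resp. `π`) fixes `∞`, the value is `δ_{a,b}` (resp. `δ_{c,d}`)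
times that of the fully contracted expression. -/
def reTr {n N : ℕ} (π ρ : Perm (Signed (PtInf n))) (A : Fin n → QMat N)
    (a b : Fin N) (c d : ℤˣ) : ℂ :=
  (2 : ℂ) ^ (-(((numCycles π / 2 : ℕ) : ℤ) - 1)) * (N : ℂ) ^ (-(((numCycles ρ / 2 : ℕ) : ℤ) - 1)) *
    ∑ i : Signed (PtInf n) → Fin N with
        (∀ k, i (delta _ k) = i (ρ k)) ∧ i (infPt n) = a ∧ i (ρ (infPt n)) = b,
      ∑ h : FD π → ℤˣ with h (infFD π) = c ∧ h (nextFD π (infFD π)) = d,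
        ∏ k : FD π with k ≠ infFD π,
          entry (signedMat A k) (i k) (i (ρ k)) (h k) (h (nextFD π k))

/-! ### Random matrices -/

instance instMeasurableSpaceQuaternion : MeasurableSpace (Quaternion ℝ) := borel _

instance instBorelSpaceQuaternion : BorelSpace (Quaternion ℝ) := ⟨rfl⟩

/-- The product σ-algebra on matrices. -/
instance instMeasurableSpaceQMat (N : ℕ) : MeasurableSpace (QMat N) :=
  inferInstanceAs (MeasurableSpace (Fin N → Fin N → Quaternion ℝ))

open Classical in
/-- The expansion of the mixed moments of the entries of `X_k`, `k ∈ I`, with coefficients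
`f : PM(I) → ℂ`: the moments are finite and, for all `ι : ±I → [N]` and `η : ±I → {1, -1}`,
`E(∏_{k ∈ I} X^{(k)}_{ι_k, ι_{-k}; η_k, η_{-k}})` is the sum of
`(∏_{k ∈ I, -k ∈ FD(α)} η_k η_{-k}) (2N)^{#(α)/2 - |I|} f(α)` over the `α ∈ PM(I)` with
`ι = ι ∘ δα` and `sgn · η = (sgn ∘ α) · (η ∘ δα)`. -/
def HasMomentExpansion {Ω : Type*} [MeasurableSpace Ω] (μ : Measure Ω) {n N : ℕ}
    (X : Fin n → Ω → QMat N) (I : Finset (Fin n)) (f : PM I → ℂ) : Prop :=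
  ∀ (ι : Signed I → Fin N) (η : Signed I → ℤˣ),
    Integrable (fun ω => ∏ k : I, entry (X k ω) (ι (k, 1)) (ι (k, -1)) (η (k, 1)) (η (k, -1))) μ ∧
    ∫ ω, ∏ k : I, entry (X k ω) (ι (k, 1)) (ι (k, -1)) (η (k, 1)) (η (k, -1)) ∂μ =
      ∑ α : PM I with
          (∀ k, ι k = ι (delta _ (α.1 k))) ∧ (∀ k, k.2 * η k = (α.1 k).2 * η (delta _ (α.1 k))),
        (∏ k : I with ((k, -1) : Signed I) ∈ FD α.1, (((η (k, 1) * η (k, -1) : ℤˣ) : ℤ) : ℂ)) *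
          (2 * (N : ℂ)) ^ (((numCycles α.1 / 2 : ℕ) : ℤ) - (I.card : ℤ)) * f α

/-! ### Colours -/

/-- `w⁻¹(c)`. -/
def colourClass {n C : ℕ} (w : Fin n → Fin C) (c : Fin C) : Finset (Fin n) :=
  Finset.univ.filter fun k => w k = c

/-- The inclusion `±I ⊆ ±[n]_∞`. -/
def inclInf {n : ℕ} (I : Finset (Fin n)) : Signed I ↪ Signed (PtInf n) where
  toFun k := (((k.1 : Fin n) : PtInf n), k.2)
  inj' := by
    rintro ⟨⟨k, hk⟩, s⟩ ⟨⟨l, hl⟩, t⟩ h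
    simpa using h

/-- `α = α₁ ⋯ α_C` as a permutation of `±[n]_∞`; each `α_c` acts trivially outside `±w⁻¹(c)`, so
`α` acts trivially on `±∞`. -/
def prodPerm {n C : ℕ} (w : Fin n → Fin C) (α : ∀ c, PM (colourClass w c)) :
    Perm (Signed (PtInf n)) :=
  ((List.finRange C).map fun c => (α c).1.viaEmbedding (inclInf (colourClass w c))).prod

/-- `ε` extended to `[n]_∞` by `ε(∞) = 1`. -/
def extSign {n : ℕ} (ε : Fin n → ℤˣ) : PtInf n → ℤˣ
  | none => 1
  | some k => ε k

/-- `δ_ε α δ_ε`. -/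
def twist {n : ℕ} (ε : Fin n → ℤˣ) (α : Perm (Signed (PtInf n))) : Perm (Signed (PtInf n)) :=
  flip (extSign ε) * α * flip (extSign ε)

end QuatExpansion

end

namespace QuatExpansion

/-! ### Counting cycles -/

/-! Expand each product `X_k^{(ε(k))} Y_k` and assign its inner indices to the point `-k`. The
contraction becomes a sum over labellings `I`, `H` of `±[n]_∞` by matrix and quaternion indices: the
`X` factor carries the labels at `k` and `-k`, the `Y` factor those at `-k` and at the image of `k`
(`reTrSum_double_mul`). Independence and the moment hypothesis turn the expected product of the `X`
factors into a sum over `α = α₁⋯α_C` (`integral_prod_starPow`). With `α' = δ_ε α δ_ε`, the term of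
`α` requires `I` to be constant and `sgn · H` to be antisymmetric along the pairing `δα'`, and
carries a sign depending on `H`. For fixed `α`, composing `I` and `H` with `φ₊δ`, for the respective
`φ`, turns these constraints into the index relations of `K(φ, α')⁻¹`; what remains is the
contraction of the `Y_k` (`sum_label_eq`). The powers of 2 and `N` are then a count of exponents
(`factor_eq`).

The essential point is that the sign of the moment expansion and the sign produced by the conjugate
transposes in the contraction of the `Y_k` differ by `(-1)^χ`, whatever `H` is (`selSign_relation`).
Given a labelling `U` antisymmetric along `δα`, consider the permutations `b` that conjugate `δ` to
`δα` and satisfy `U ∘ b = sgn`. Two of them differ by an even permutation, so `sign b` depends only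
on `δα` and `U` (`sign_eq_of_conj`). Computing it once from the cycles of `α` and once from those of
`K(φ, α)` relates the two products of labels through the signs of three permutations of `J`
(`sign_relation`), and these signs are determined by the cycle counts occurring in `χ`. -/

theorem perm_apply_inv {S : Type} (σ : Perm S) (x : S) : σ (σ⁻¹ x) = x := σ.apply_symm_apply x

theorem apply_zpow_of_semiconj {S T : Type} {σ : Perm S} {τ : Perm T} {e : S → T}
    (h : ∀ x, τ (e x) = e (σ x)) (j : ℤ) (x : S) : (τ ^ j) (e x) = e ((σ ^ j) x) := by
  have hn : ∀ (m : ℕ) x, (τ ^ m) (e x) = e ((σ ^ m) x) := by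
    intro m
    induction m with
    | zero => intro x; simp
    | succ m ih => intro x; rw [pow_succ, pow_succ, Perm.mul_apply, Perm.mul_apply, h, ih]
  cases j with
  | ofNat m => simpa using hn m x
  | negSucc m =>
    rw [zpow_negSucc, zpow_negSucc, Perm.inv_eq_iff_eq, hn, perm_apply_inv]

/-- No orbit crosses a block when `S` splits into `τ`-stable blocks. This serves both for the two
signed copies of `J` and for the colour classes. -/
theorem numCycles_eq_sum {T S : Type} [Fintype T] {R : T → Type} [∀ t, Finite (R t)]
    (E : (Σ t, R t) ≃ S) (τ : Perm S) (σ : ∀ t, Perm (R t))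
    (h : ∀ t x, τ (E ⟨t, x⟩) = E ⟨t, σ t x⟩) :
    numCycles τ = ∑ t, numCycles (σ t) := by
  have hz := fun t (x : R t) (j : ℤ) =>
    apply_zpow_of_semiconj (σ := σ t) (τ := τ) (e := fun x => E ⟨t, x⟩) (h t) j x
  let F : (Σ t, Quotient (Perm.SameCycle.setoid (σ t))) → Quotient (Perm.SameCycle.setoid τ) :=
    fun q => Quotient.map (fun x => E ⟨q.1, x⟩)
      (fun x y h => by
        obtain ⟨j, hj⟩ : (σ q.1).SameCycle x y := h
        exact (⟨j, by rw [hz, hj]⟩ : τ.SameCycle _ _)) q.2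
  have hF : Function.Bijective F := by
    constructor
    · rintro ⟨t, q⟩ ⟨t', q'⟩ hq
      induction q using Quotient.inductionOn with | _ x => ?_
      induction q' using Quotient.inductionOn with | _ y => ?_
      obtain ⟨j, hj⟩ := Quotient.exact hq
      simp only [hz] at hj
      have := E.injective hj
      simp only [Sigma.mk.injEq] at this
      obtain ⟨rfl, hj⟩ := this
      simp only [heq_eq_eq] at hj
      congr 1
      exact Quotient.sound ⟨j, hj⟩
    · intro q
      induction q using Quotient.inductionOn with | _ x => ?_
      obtain ⟨⟨t, y⟩, rfl⟩ := E.surjective x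
      exact ⟨⟨t, ⟦y⟧⟩, rfl⟩
  rw [numCycles, ← Nat.card_eq_of_bijective F hF, Nat.card_sigma]
  rfl

theorem numCycles_eq_of_equiv {S T : Type} [Finite S] (E : S ≃ T) (σ : Perm S) (τ : Perm T)
    (h : ∀ x, τ (E x) = E (σ x)) : numCycles τ = numCycles σ := by
  have := numCycles_eq_sum (T := Unit) ((Equiv.uniqueSigma fun _ : Unit => S).trans E) τ
    (fun _ => σ) (fun _ x => h x)
  simpa using this

theorem numCycles_conj {S : Type} [Finite S] (σ τ : Perm S) :
    numCycles (τ * σ * τ⁻¹) = numCycles σ :=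
  numCycles_eq_of_equiv τ σ _ fun x => by simp

theorem numCycles_inv {S : Type} (σ : Perm S) : numCycles σ⁻¹ = numCycles σ := by
  have : Perm.SameCycle.setoid σ⁻¹ = Perm.SameCycle.setoid σ := by
    ext x y; exact Perm.sameCycle_inv
  rw [numCycles, numCycles, this]

/-- `cycleType` ignores fixed points, whereas `numCycles` counts them; orbits are therefore matched
with nontrivial cycles together with fixed points. -/
theorem sign_eq_neg_one_pow {S : Type} [Fintype S] [DecidableEq S] (σ : Perm S) :
    Perm.sign σ = (-1) ^ (Fintype.card S + numCycles σ) := by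
  have hne : ∀ c : σ.cycleFactorsFinset, ∃ x, x ∈ c.1.support := fun c =>
    (Perm.mem_cycleFactorsFinset_iff.1 c.2).1.nonempty_support
  choose p hp using hne
  have hsupp : ∀ c : σ.cycleFactorsFinset, c.1 = σ.cycleOf (p c) := fun c =>
    Perm.cycle_is_cycleOf (hp c) c.2
  have hmv : ∀ c : σ.cycleFactorsFinset, σ (p c) ≠ p c := fun c =>
    Perm.mem_support.1 (Perm.mem_cycleFactorsFinset_support_le c.2 (hp c))
  let F : σ.cycleFactorsFinset ⊕ Function.fixedPoints σ → Quotient (Perm.SameCycle.setoid σ) :=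
    Sum.elim (fun c => ⟦p c⟧) (fun x => ⟦x.1⟧)
  have hF : Function.Bijective F := by
    constructor
    · rintro (c | x) (c' | x') h
      · have h' : σ.SameCycle (p c) (p c') := Quotient.exact h
        congr 1
        ext1
        rw [hsupp c, hsupp c', h'.cycleOf_eq]
      · have h' : σ.SameCycle (p c) x' := Quotient.exact h
        exact absurd (h'.apply_eq_self_iff.2 x'.2) (hmv c)
      · have h' : σ.SameCycle x (p c') := Quotient.exact h
        exact absurd (h'.apply_eq_self_iff.1 x.2) (hmv c')
      · have h' : σ.SameCycle x x' := Quotient.exact h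
        congr 1
        ext1
        exact h'.eq_of_left x.2
    · intro q
      induction q using Quotient.inductionOn with | _ x => ?_
      by_cases hx : σ x = x
      · exact ⟨Sum.inr ⟨x, hx⟩, rfl⟩
      · have hc : σ.cycleOf x ∈ σ.cycleFactorsFinset :=
          Perm.cycleOf_mem_cycleFactorsFinset_iff.2 (Perm.mem_support.2 hx)
        refine ⟨Sum.inl ⟨_, hc⟩, Quotient.sound ?_⟩
        exact ((Perm.mem_support_cycleOf_iff.1 (hp ⟨_, hc⟩)).1).symm
  have hcard : numCycles σ = Multiset.card σ.cycleType + (Fintype.card S - σ.cycleType.sum) := by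
    rw [numCycles, ← Nat.card_eq_of_bijective F hF, Nat.card_sum, Nat.card_eq_fintype_card,
      Nat.card_eq_fintype_card, Perm.card_fixedPoints, Fintype.card_coe, Perm.cycleType_def]
    simp
  have hle : σ.cycleType.sum ≤ Fintype.card S := by
    rw [Perm.sum_cycleType]; exact Finset.card_le_univ _
  rw [Perm.sign_of_cycleType, hcard]
  obtain ⟨r, hr⟩ := Nat.exists_eq_add_of_le hle
  rw [hr, Nat.add_sub_cancel_left]
  simp only [pow_add]
  have : ((-1 : ℤˣ) ^ r) * (-1) ^ r = 1 := by rw [← mul_pow]; simp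
  calc _ = (-1 : ℤˣ) ^ σ.cycleType.sum * (-1) ^ Multiset.card σ.cycleType * ((-1) ^ r * (-1) ^ r) := by
        rw [this, mul_one]
    _ = _ := by ac_rfl

/-! ### Signed permutations -/

section Signed

variable {J : Type}

@[simp] theorem flip_apply (ε : J → ℤˣ) (k : Signed J) : flip ε k = (k.1, ε k.1 * k.2) := rfl

@[simp] theorem delta_apply (k : Signed J) : delta J k = (k.1, -k.2) := by
  simp [delta]

theorem flip_one : flip (fun _ : J => (1 : ℤˣ)) = 1 := by
  ext k <;> simp

@[simp] theorem flip_mul_self (ε : J → ℤˣ) : flip ε * flip ε = 1 := by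
  ext k <;> simp [← mul_assoc]

@[simp] theorem flip_inv (ε : J → ℤˣ) : (flip ε)⁻¹ = flip ε :=
  inv_eq_of_mul_eq_one_left (flip_mul_self ε)

theorem delta_mul_self : delta J * delta J = 1 := flip_mul_self _

theorem delta_inv : (delta J)⁻¹ = delta J := flip_inv _

theorem delta_mul_flip (ε : J → ℤˣ) : delta J * flip ε = flip ε * delta J := by
  ext k <;> simp

theorem delta_ne (k : Signed J) : delta J k ≠ k := by
  intro h
  have := congrArg Prod.snd h
  simp only [delta_apply] at this
  revert this
  rcases Int.units_eq_one_or k.2 with h | h <;> rw [h] <;> decide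

@[simp] theorem plus_pos (φ : Perm J) (j : J) : plus φ (j, 1) = (φ j, 1) := rfl

@[simp] theorem plus_neg (φ : Perm J) (j : J) : plus φ (j, -1) = (j, -1) := rfl

@[simp] theorem plus_inv (φ : Perm J) : (plus φ)⁻¹ = plus φ⁻¹ := rfl

@[simp] theorem minus_pos (φ : Perm J) (j : J) : minus φ (j, 1) = (j, 1) := by
  simp [minus]

@[simp] theorem minus_neg (φ : Perm J) (j : J) : minus φ (j, -1) = (φ j, -1) := by
  simp [minus]

theorem minus_inv (φ : Perm J) : (minus φ)⁻¹ = minus φ⁻¹ := by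
  simp only [minus, mul_inv_rev, delta_inv, plus_inv, mul_assoc]

@[simp] theorem double_pos (φ : Perm J) (j : J) : double φ (j, 1) = (φ j, 1) := by
  simp [double, minus_inv]

@[simp] theorem double_neg (φ : Perm J) (j : J) : double φ (j, -1) = (φ⁻¹ j, -1) := by
  simp [double, minus_inv]

theorem signed_ext {T : Type} {f g : Signed J → T} (h1 : ∀ j, f (j, 1) = g (j, 1))
    (h2 : ∀ j, f (j, -1) = g (j, -1)) : f = g := by
  funext ⟨j, s⟩
  rcases Int.units_eq_one_or s with rfl | rfl
  · exact h1 j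
  · exact h2 j

theorem double_eq_K_one (φ : Perm J) : double φ = (K φ 1)⁻¹ := by
  apply Equiv.coe_fn_injective
  apply signed_ext <;> intro j <;> simp [K, minus_inv]

theorem prod_signed [Fintype J] {M : Type*} [CommMonoid M] (g : Signed J → M) :
    ∏ k, g k = ∏ j, g (j, 1) * g (j, -1) := by
  rw [Fintype.prod_prod_type]
  refine Finset.prod_congr rfl fun j _ => ?_
  rw [show (Finset.univ : Finset ℤˣ) = {1, -1} from rfl, Finset.prod_pair (by decide)]

/-! ### Signs -/

theorem sign_plus [Fintype J] [DecidableEq J] (φ : Perm J) :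
    Perm.sign (plus φ) = Perm.sign φ := by
  have : plus φ = prodCongrLeft fun s : ℤˣ => if s = 1 then φ else 1 := by
    apply Equiv.coe_fn_injective
    apply signed_ext <;> intro j <;> simp
  rw [this, Perm.sign_prodCongrLeft, show (Finset.univ : Finset ℤˣ) = {1, -1} from rfl,
    Finset.prod_pair (by decide)]
  simp

theorem sign_minus [Fintype J] [DecidableEq J] (φ : Perm J) :
    Perm.sign (minus φ) = Perm.sign φ := by
  rw [minus, map_mul, map_mul, sign_plus, mul_right_comm, ← map_mul, delta_mul_self, map_one,
    one_mul]

theorem sign_flip [Fintype J] [DecidableEq J] (ε : J → ℤˣ) :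
    Perm.sign (flip ε) = ∏ j, ε j := by
  have : flip ε = prodCongrRight fun j => Equiv.mulLeft (ε j) := by
    ext k <;> rfl
  rw [this, Perm.sign_prodCongrRight]
  refine Finset.prod_congr rfl fun j _ => ?_
  generalize ε j = s
  revert s
  decide

/-- A permutation that commutes with `δ` and preserves signs is even. -/
theorem sign_eq_one_of_commute [Fintype J] [DecidableEq J] (τ : Perm (Signed J))
    (h1 : ∀ k, (τ k).2 = k.2) (h2 : τ * delta J = delta J * τ) : Perm.sign τ = 1 := by
  have h1' : ∀ k, (τ⁻¹ k).2 = k.2 := fun k => by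
    conv_rhs => rw [← perm_apply_inv τ k, h1]
  have hpos : ∀ j, τ (j, 1) = ((τ (j, 1)).1, 1) := fun j => Prod.ext rfl (h1 _)
  have hpos' : ∀ j, τ⁻¹ (j, 1) = ((τ⁻¹ (j, 1)).1, 1) := fun j => Prod.ext rfl (h1' _)
  let t : Perm J :=
    { toFun := fun j => (τ (j, 1)).1
      invFun := fun j => (τ⁻¹ (j, 1)).1
      left_inv := fun j => by
        show (τ⁻¹ ((τ (j, 1)).1, 1)).1 = j
        rw [← hpos]; simp
      right_inv := fun j => by
        show (τ ((τ⁻¹ (j, 1)).1, 1)).1 = j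
        rw [← hpos']; simp }
  have : τ = plus t * minus t := by
    apply Equiv.coe_fn_injective
    apply signed_ext <;> intro j
    · simpa [t] using hpos j
    · have := Perm.congr_fun h2 (j, 1)
      simp only [Perm.mul_apply, delta_apply] at this
      simpa [h1, t] using this
  rw [this, map_mul, sign_plus, sign_minus, Int.units_mul_self]

/-- The quotient `b⁻¹ * b'` commutes with `δ` and preserves signs, hence acts by the same
permutation on both copies of `J` and is even. -/
theorem sign_eq_of_conj [Fintype J] [DecidableEq J] (b b' : Perm (Signed J)) (U : Signed J → ℤˣ)
    (h : ∀ k, U (b k) = k.2) (h' : ∀ k, U (b' k) = k.2)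
    (hc : b * delta J * b⁻¹ = b' * delta J * b'⁻¹) : Perm.sign b = Perm.sign b' := by
  have := sign_eq_one_of_commute (b⁻¹ * b') (fun k => by
    rw [← h, Perm.mul_apply, perm_apply_inv, h']) (by
    calc b⁻¹ * b' * delta J = b⁻¹ * (b' * delta J * b'⁻¹) * b' := by group
      _ = b⁻¹ * (b * delta J * b⁻¹) * b' := by rw [hc]
      _ = delta J * (b⁻¹ * b') := by group)
  rw [map_mul, Perm.sign_inv] at this
  have h2 := congrArg (Perm.sign b * ·) this
  simpa [← mul_assoc] using h2.symm

end Signed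

/-! ### Structure of `PM(J)` and the sign identity for labellings -/

section Structure

variable {J : Type}

/-- `e` selects one element `(j, e j)` of each pair `±j`, and the selected set is stable
under `α`. -/
def IsSelection (α : Perm (Signed J)) (e : J → ℤˣ) : Prop :=
  ∀ k : Signed J, k.2 = e k.1 → (α k).2 = e (α k).1

theorem delta_comp_self (k : Signed J) : delta J (delta J k) = k := by simp

/-- Excluding `π k = -k` suffices. If `-k = π^i k`, move to the midpoint `π^m k`: for `i = 2m` it
would be fixed by `δ`, and for `i = 2m + 1` it would be sent to its negative by `π`. -/
theorem isPM_of_ne {π : Perm (Signed J)} (h : delta J * π * delta J = π⁻¹)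
    (h2 : ∀ k, π k ≠ delta J k) : IsPM π := by
  have hz : ∀ (i : ℤ) x, delta J ((π ^ i) x) = (π ^ (-i)) (delta J x) := by
    intro i x
    have h' : delta J * π ^ i * (delta J)⁻¹ = (π⁻¹) ^ i := by
      rw [← h]
      have := (conj_zpow (i := i) (a := delta J) (b := π)).symm
      rwa [delta_inv] at *
    rw [inv_zpow', delta_inv] at h'
    rw [← h']
    simp
  refine ⟨h, ?_⟩
  rintro k ⟨i, hi⟩
  rcases Int.even_or_odd' i with ⟨m, rfl | rfl⟩
  · apply delta_ne ((π ^ m) k)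
    rw [hz, ← hi, ← Perm.mul_apply, ← zpow_add]
    congr 2; ring
  · apply h2 ((π ^ m) k)
    rw [hz, ← hi, ← Perm.mul_apply, ← Perm.mul_apply, ← zpow_add, ← zpow_one_add]
    congr 2; ring

theorem IsPM.apply_ne {π : Perm (Signed J)} (h : IsPM π) (k : Signed J) : π k ≠ delta J k :=
  fun hk => h.2 k ⟨1, by simpa using hk⟩

theorem IsPM.delta_apply_apply {π : Perm (Signed J)} (h : IsPM π) (k : Signed J) :
    π (delta J (π k)) = delta J k := by
  have := Perm.congr_fun h.1 (delta J k)
  simp only [Perm.mul_apply, delta_comp_self] at this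
  have h2 := congrArg π this
  rw [perm_apply_inv] at h2
  exact h2

theorem isPM_of_apply {π : Perm (Signed J)} (h : ∀ k, π (delta J (π k)) = delta J k)
    (h2 : ∀ k, π k ≠ delta J k) : IsPM π := by
  refine isPM_of_ne ?_ h2
  ext1 k
  rw [eq_comm, Perm.inv_eq_iff_eq]
  simp only [Perm.mul_apply]
  rw [h, delta_comp_self]

theorem IsPM.inv {π : Perm (Signed J)} (h : IsPM π) : IsPM π⁻¹ := by
  refine ⟨?_, fun k hk => h.2 k (Perm.sameCycle_inv.1 hk)⟩
  rw [inv_inv, ← h.1, mul_assoc, mul_assoc, delta_mul_self, mul_one, ← mul_assoc,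
    delta_mul_self, one_mul]

theorem isPM_one : IsPM (1 : Perm (Signed J)) :=
  isPM_of_apply (fun _ => rfl) fun k h => delta_ne k h.symm

theorem delta_plus_delta (φ : Perm J) (k : Signed J) :
    delta J (minus φ (delta J k)) = plus φ k := by
  simp only [minus, Perm.mul_apply, delta_comp_self]

theorem IsPM.K {α : Perm (Signed J)} (h : IsPM α) (φ : Perm J) :
    IsPM (QuatExpansion.K φ α) := by
  have hm : ∀ k, minus φ (delta J k) = delta J (plus φ k) := fun k => by
    rw [← delta_plus_delta, delta_comp_self]
  refine isPM_of_apply (fun k => ?_) fun k hk => ?_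
  · simp only [QuatExpansion.K, Perm.mul_apply]
    rw [Perm.inv_eq_iff_eq, hm, perm_apply_inv, h.inv.delta_apply_apply]
    rw [← delta_plus_delta φ (delta J k), delta_comp_self]
  · simp only [QuatExpansion.K, Perm.mul_apply] at hk
    rw [Perm.inv_eq_iff_eq, ← delta_plus_delta, delta_comp_self] at hk
    exact h.inv.apply_ne _ hk

theorem isPM_twist {α : Perm (Signed J)} (h : IsPM α) (e : J → ℤˣ) :
    IsPM (flip e * α * flip e) := by
  have hc : ∀ k, flip e (delta J k) = delta J (flip e k) := fun k => by simp
  have hs : ∀ k, flip e (flip e k) = k := fun k => by simp [← mul_assoc]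
  refine isPM_of_apply (fun k => ?_) fun k hk => ?_
  · simp only [Perm.mul_apply]
    rw [hc, hs, h.delta_apply_apply, hc, hs]
  · simp only [Perm.mul_apply] at hk
    apply h.apply_ne (flip e k)
    rw [← hs (α _), hk, hc]

/-- Conjugating by `flip e` moves the selected elements to the positive copy of `J`, which is then
stable. The action there is `β`, and the symmetry under `δ` forces `β⁻¹` on the negative copy. -/
theorem exists_eq_double [Finite J] {α : Perm (Signed J)} (h : IsPM α) {e : J → ℤˣ}
    (he : IsSelection α e) : ∃ β : Perm J, α = flip e * double β * flip e := by
  set α' := flip e * α * flip e with hα'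
  have h' : IsPM α' := isPM_twist h e
  have hpos : ∀ j, α' (j, 1) = ((α' (j, 1)).1, 1) := by
    intro j
    refine Prod.ext rfl ?_
    have := he (j, e j) rfl
    simp only [hα', Perm.mul_apply, flip_apply, mul_one]
    rw [this, Int.units_mul_self]
  let b : J → J := fun j => (α' (j, 1)).1
  have hb : Function.Injective b := by
    intro j j' hj
    have : α' (j, 1) = α' (j', 1) := by
      rw [hpos j, hpos j']; exact Prod.ext hj rfl
    exact congrArg Prod.fst (α'.injective this)
  let β : Perm J := Equiv.ofBijective b (Finite.injective_iff_bijective.1 hb)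
  have hβ : ∀ j, α' (j, 1) = (β j, 1) := hpos
  have key : α' = double β := by
    apply Equiv.coe_fn_injective
    apply signed_ext <;> intro j
    · simpa using hβ j
    · have := h'.delta_apply_apply (β⁻¹ j, 1)
      rw [hβ, perm_apply_inv] at this
      simpa using this
  refine ⟨β, ?_⟩
  rw [← key, hα']
  simp only [mul_assoc, flip_mul_self, mul_one]
  rw [← mul_assoc, flip_mul_self, one_mul]

theorem numCycles_flip_double [Finite J] (e : J → ℤˣ) (β : Perm J) :
    numCycles (flip e * double β * flip e) = 2 * numCycles β := by
  have h1 := numCycles_conj (double β) (flip e)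
  rw [flip_inv] at h1
  rw [h1]
  have h2 := numCycles_eq_sum (T := ℤˣ) (R := fun _ => J)
    ((Equiv.sigmaEquivProd ℤˣ J).trans (Equiv.prodComm ℤˣ J)) (double β)
    (fun s => if s = 1 then β else β⁻¹) (fun s x => by
      rcases Int.units_eq_one_or s with rfl | rfl <;> simp)
  rw [h2, show (Finset.univ : Finset ℤˣ) = {1, -1} from rfl, Finset.sum_pair (by decide)]
  simp [numCycles_inv, two_mul]

theorem numCycles_double [Finite J] (β : Perm J) : numCycles (double β) = 2 * numCycles β := by
  have := numCycles_flip_double (fun _ => 1) β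
  rwa [flip_one, one_mul, mul_one] at this

theorem minus_mul_delta (β : Perm J) : minus β * delta J = delta J * plus β := by
  simp only [minus, mul_assoc, delta_mul_self, mul_one]

/-- A labelling that is antisymmetric along `δα` turns `δα` into `δ`, by a permutation of
known sign. -/
theorem exists_sign_conj [Fintype J] [DecidableEq J] {α : Perm (Signed J)} {e : J → ℤˣ}
    {β : Perm J} (hα : α = flip e * double β * flip e) {U : Signed J → ℤˣ}
    (hU : ∀ k, U (delta J (α k)) = -U k) :
    ∃ b : Perm (Signed J), (∀ k, U (b k) = k.2) ∧ b * delta J * b⁻¹ = delta J * α ∧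
      Perm.sign b = (∏ j, e j * U (j, e j)) * Perm.sign β := by
  -- `minus β` conjugates `δ` to `δ * double β`, and `flip e` carries this to `δα`. The rightmost
  -- flip commutes with `δ`, so it is free to correct the values of `U`.
  refine ⟨flip e * minus β * flip fun j => U (j, e j), fun k => ?_, ?_, ?_⟩
  · obtain ⟨j, s⟩ := k
    simp only [Perm.mul_apply, flip_apply]
    generalize hr : U (j, e j) * s = r
    have hs : s = U (j, e j) * r := by rw [← hr, ← mul_assoc, Int.units_mul_self, one_mul]
    rcases Int.units_eq_one_or r with rfl | rfl
    · simp [hs]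
    · have := hU (j, e j)
      rw [hα] at this
      simp only [Perm.mul_apply, flip_apply, Int.units_mul_self, double_pos, mul_one,
        delta_apply] at this
      simp only [minus_neg, mul_neg, mul_one, this, hs]
  · rw [hα]
    simp only [mul_inv_rev, flip_inv]
    calc _ = flip e * minus β * ((flip fun j => U (j, e j)) * delta J *
          flip fun j => U (j, e j)) * (minus β)⁻¹ * flip e := by simp only [mul_assoc]
      _ = flip e * (minus β * delta J) * (minus β)⁻¹ * flip e := by
        rw [← delta_mul_flip, mul_assoc (delta J), flip_mul_self, mul_one]
        simp only [mul_assoc]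
      _ = (flip e * delta J) * plus β * (minus β)⁻¹ * flip e := by
        rw [minus_mul_delta]; simp only [mul_assoc]
      _ = _ := by rw [← delta_mul_flip, double]; simp only [mul_assoc]
  · rw [map_mul, map_mul, sign_flip, sign_flip, sign_minus, Finset.prod_mul_distrib,
      mul_right_comm]

/-- Since `U ∘ b = sgn` for a bijection `b`, the labelling `U = sgn · H` has the same total product
as `sgn`. -/
theorem prod_label_eq_one [Fintype J] [DecidableEq J] {α : Perm (Signed J)} {e : J → ℤˣ}
    {β : Perm J} (hα : α = flip e * double β * flip e) {H : Signed J → ℤˣ}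
    (hH : ∀ k, k.2 * H k = (α k).2 * H (delta J (α k))) :
    ∏ j, H (j, 1) * H (j, -1) = 1 := by
  obtain ⟨b, hb, -, -⟩ := exists_sign_conj hα (U := fun k => k.2 * H k) (fun k => by
    simp only [hH k, delta_apply, neg_mul])
  have h1 : ∏ k : Signed J, k.2 * H k = ∏ k : Signed J, k.2 := by
    rw [← Equiv.prod_comp b]
    exact Finset.prod_congr rfl fun k _ => hb k
  rw [Finset.prod_mul_distrib, mul_eq_left] at h1
  rw [← prod_signed, h1]

/-- The same conjugating sign is evaluated twice: with `b` built from `α`, and with `φ₊ δ b' δ`,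
where `b'` is built from `K φ α`. Both conjugate `δ` to `δα`. -/
theorem sign_relation [Fintype J] [DecidableEq J] {φ β γ : Perm J} {α : Perm (Signed J)}
    {e e' : J → ℤˣ} (hα : α = flip e * double β * flip e) (hα' : IsPM α)
    (hK : K φ α = flip e' * double γ * flip e')
    {H : Signed J → ℤˣ} (hH : ∀ k, k.2 * H k = (α k).2 * H (delta J (α k))) :
    (∏ j, H (j, e j)) * ∏ j, H (plus φ (delta J (j, e' j))) =
      Perm.sign φ * Perm.sign β * Perm.sign γ := by
  set U : Signed J → ℤˣ := fun k => k.2 * H k with hUdef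
  have hU : ∀ k, U (delta J (α k)) = -U k := fun k => by
    simp only [hUdef, hH k, delta_apply, neg_mul]
  have hUi : ∀ k, U (α⁻¹ k) = -U (delta J k) := fun k => by
    have := hU (α⁻¹ k)
    rw [perm_apply_inv] at this
    rw [this, neg_neg]
  -- As `φ₊` preserves signs, `V` is `sgn` times the transported labelling `H ∘ φ₊δ`, hence the
  -- analogue of `U` for `K φ α`.
  set V : Signed J → ℤˣ := fun k => -U (plus φ (delta J k)) with hVdef
  have hV : ∀ k, V (delta J (K φ α k)) = -V k := fun k => by
    simp only [hVdef, delta_comp_self, K, Perm.mul_apply, perm_apply_inv, hUi]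
    rw [← delta_plus_delta, delta_comp_self]
  obtain ⟨b, hb, hbc, hbs⟩ := exists_sign_conj hα hU
  obtain ⟨b', hb', hbc', hbs'⟩ := exists_sign_conj hK hV
  have hsign := sign_eq_of_conj b (plus φ * delta J * b' * delta J) U hb (fun k => by
    have := hb' (delta J k)
    simp only [hVdef, delta_apply] at this
    simp only [Perm.mul_apply, delta_apply]
    rw [← neg_neg (U _), this, neg_neg]) (by
    rw [hbc]
    simp only [mul_inv_rev, delta_inv]
    calc delta J * α = α⁻¹ * delta J := by
          rw [← hα'.1, mul_assoc, mul_assoc, delta_mul_self, mul_one]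
      _ = plus φ * K φ α * delta J * (plus φ)⁻¹ := by
        rw [K, mul_assoc _ _ (delta J), mul_assoc _ _ (delta J), minus_mul_delta]
        group
      _ = plus φ * delta J * (b' * delta J * b'⁻¹) * delta J * (plus φ)⁻¹ := by
        rw [hbc', ← mul_assoc, mul_assoc (plus φ) (delta J) (delta J), delta_mul_self, mul_one]
      _ = plus φ * delta J * b' * (delta J * delta J) * delta J * b'⁻¹ * delta J
          * (plus φ)⁻¹ := by
        rw [delta_mul_self]; group
      _ = _ := by simp only [mul_assoc])
  have hd : Perm.sign (plus φ * delta J * b' * delta J) = Perm.sign φ * Perm.sign b' := by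
    simp only [map_mul, sign_plus]
    rw [mul_right_comm (Perm.sign φ), mul_assoc, Int.units_mul_self, mul_one]
  rw [hd, hbs, hbs'] at hsign
  have h1 : ∀ j, e j * U (j, e j) = H (j, e j) := fun j => by
    simp only [hUdef, ← mul_assoc, Int.units_mul_self, one_mul]
  have h2 : ∀ j, e' j * V (j, e' j) = H (plus φ (delta J (j, e' j))) := fun j => by
    simp only [hVdef, hUdef, delta_apply]
    rcases Int.units_eq_one_or (e' j) with h | h <;> simp [h]
  simp only [h1, h2] at hsign
  generalize (∏ j, H (j, e j)) = x at *
  generalize (∏ j, H (plus φ (delta J (j, e' j)))) = y at *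
  generalize Perm.sign φ = p at *
  generalize Perm.sign β = q at *
  generalize Perm.sign γ = r at *
  clear * - hsign
  revert hsign
  revert x y p q r
  decide

theorem sameCycle_delta {π : Perm (Signed J)} (h : IsPM π) {k l : Signed J}
    (hk : π.SameCycle k l) : π.SameCycle (delta J k) (delta J l) := by
  have h1 : (delta J * π * (delta J)⁻¹).SameCycle k l := by
    rwa [delta_inv, h.1, Perm.sameCycle_inv]
  simpa only [delta_inv] using Perm.sameCycle_conj.1 h1

/-! ### The fundamental domain -/

variable [Fintype J] [LinearOrder J]

open Classical in
/-- The signs of the elements of `FD(π)`. -/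
noncomputable def signFD (π : Perm (Signed J)) (j : J) : ℤˣ := if (j, 1) ∈ FD π then 1 else -1

/-- `δ` exchanges the two cycles of a pair and preserves absolute values, so both have the same
least index. It has opposite signs in the two, since no cycle contains both `m` and `-m`. -/
theorem delta_mem_FD_iff {π : Perm (Signed J)} (h : IsPM π) (k : Signed J) :
    delta J k ∈ FD π ↔ k ∉ FD π := by
  classical
  simp only [FD, Finset.mem_filter, Finset.mem_univ, true_and]
  constructor
  · rintro ⟨m, hm, hmin⟩ ⟨m', hm', hmin'⟩
    have h1 := sameCycle_delta h hm'
    have h2 : m ≤ m' := by simpa using hmin _ h1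
    have h3 := sameCycle_delta h hm
    rw [delta_comp_self] at h3
    have h4 : m' ≤ m := by simpa using hmin' _ h3
    obtain rfl := le_antisymm h2 h4
    exact h.2 (m, 1) (hm'.symm.trans h3)
  · intro hk
    obtain ⟨l, hl, hmin⟩ := Finset.exists_min_image
      (Finset.univ.filter fun l => π.SameCycle k l) Prod.fst ⟨k, by simp [Perm.SameCycle.refl]⟩
    simp only [Finset.mem_filter, Finset.mem_univ, true_and] at hl hmin
    obtain ⟨m, s⟩ := l
    rcases Int.units_eq_one_or s with rfl | rfl
    · exact absurd ⟨m, hl, hmin⟩ hk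
    · refine ⟨m, by simpa using sameCycle_delta h hl, fun l hkl => ?_⟩
      have := sameCycle_delta h hkl
      rw [delta_comp_self] at this
      simpa using hmin _ this

theorem mem_FD_iff {π : Perm (Signed J)} (h : IsPM π) (k : Signed J) :
    k ∈ FD π ↔ k.2 = signFD π k.1 := by
  obtain ⟨j, s⟩ := k
  have := delta_mem_FD_iff h (j, 1)
  rw [delta_apply] at this
  simp only at this
  unfold signFD
  rcases Int.units_eq_one_or s with rfl | rfl <;> by_cases hj : (j, (1 : ℤˣ)) ∈ FD π <;>
    simp [hj, this]

theorem isSelection_signFD {π : Perm (Signed J)} (h : IsPM π) : IsSelection π (signFD π) :=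
  fun k hk => (mem_FD_iff h _).1 (apply_mem_FD π ((mem_FD_iff h k).2 hk))

theorem FD_inv (π : Perm (Signed J)) : FD π⁻¹ = FD π := by
  ext k
  simp only [FD, Perm.sameCycle_inv]

theorem even_numCycles {π : Perm (Signed J)} (h : IsPM π) : 2 * (numCycles π / 2) = numCycles π := by
  obtain ⟨β, hβ⟩ := exists_eq_double h (isSelection_signFD h)
  rw [hβ, numCycles_flip_double]
  omega

end Structure

/-! ### The sign of a labelling -/

section Sign

variable {J : Type} [Fintype J]

/-- The product of `H k * H (-k)` over the pairs `±k` of which `-k` is selected by `e`. -/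
def selSign (e : J → ℤˣ) (H : Signed J → ℤˣ) : ℤˣ :=
  ∏ j, if e j = 1 then 1 else H (j, 1) * H (j, -1)

theorem selSign_eq (e : J → ℤˣ) (H : Signed J → ℤˣ) :
    selSign e H = ∏ j, H (j, 1) * H (j, e j) := by
  refine Finset.prod_congr rfl fun j _ => ?_
  rcases Int.units_eq_one_or (e j) with h | h <;> simp [h]

/-- The selection `e` is arbitrary because the one arising from the moment expansion is a twist by
`ε` of fundamental domains. The factors at the positive points combine to the full product of `H`,
which is 1 by `prod_label_eq_one`; the rest is `sign_relation`. -/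
theorem selSign_relation [LinearOrder J] {φ : Perm J} {α : Perm (Signed J)} (hα : IsPM α)
    {e : J → ℤˣ} (he : IsSelection α e) {H : Signed J → ℤˣ}
    (hH : ∀ k, k.2 * H k = (α k).2 * H (delta J (α k))) :
    selSign e H = (-1) ^ chi φ α *
      selSign (signFD (K φ α)⁻¹) (fun k => H (plus φ (delta J k))) := by
  obtain ⟨β, hβ⟩ := exists_eq_double hα he
  obtain ⟨γ, hγ⟩ := exists_eq_double (hα.K φ) (isSelection_signFD (hα.K φ))
  have hFD : signFD (K φ α)⁻¹ = signFD (K φ α) := by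
    funext j; simp only [signFD, FD_inv]
  rw [hFD]
  have h1 := sign_relation hβ hα hγ hH
  have h2 := prod_label_eq_one hβ hH
  have h3 : selSign e H *
      selSign (signFD (K φ α)) (fun k => H (plus φ (delta J k))) = (-1) ^ chi φ α := by
    rw [selSign_eq, selSign_eq, ← Finset.prod_mul_distrib]
    calc _ = (∏ j, H (j, 1) * H (j, -1)) * ((∏ j, H (j, e j)) *
          ∏ j, H (plus φ (delta J (j, signFD (K φ α) j)))) := by
          rw [← Finset.prod_mul_distrib, ← Finset.prod_mul_distrib]
          refine Finset.prod_congr rfl fun j _ => ?_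
          have : plus φ (delta J (j, 1)) = (j, -1) := by simp
          rw [this]
          ac_rfl
      _ = (-1) ^ chi φ α := by
          rw [h2, h1, one_mul, sign_eq_neg_one_pow, sign_eq_neg_one_pow, sign_eq_neg_one_pow]
          have e1 : numCycles (double φ) / 2 = numCycles φ := by rw [numCycles_double]; omega
          have e2 : numCycles α / 2 = numCycles β := by rw [hβ, numCycles_flip_double]; omega
          have e3 : numCycles (K φ α) / 2 = numCycles γ := by
            rw [hγ, numCycles_flip_double]; omega
          rw [chi, e1, e2, e3, ← pow_add, ← pow_add, ← zpow_natCast]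
          -- The three permutation signs contribute `3|J|` to the exponent where `χ` has `-|J|`; the
          -- difference `4|J|` is even.
          have h4 : ((-1 : ℤˣ)) ^ (4 * (Fintype.card J : ℤ)) = 1 := by
            rw [zpow_mul]; norm_num
          have h5 : ∀ m p q r : ℕ, ((m + p + (m + q) + (m + r) : ℕ) : ℤ) =
              ((p : ℤ) + q + r - m) + 4 * m := fun m p q r => by push_cast; ring
          rw [h5, zpow_add, h4, mul_one]
  rw [← h3, mul_assoc, Int.units_mul_self, mul_one]

end Sign

/-! ### Reindexing labellings -/

section Reindex

variable {J : Type}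

theorem delta_snd (k : Signed J) : (delta J k).2 = -k.2 := by simp

theorem plus_delta_K_inv (φ : Perm J) (α : Perm (Signed J)) (k : Signed J) :
    plus φ (delta J ((K φ α)⁻¹ k)) = delta J (α (plus φ k)) := by
  simp only [K, mul_inv_rev, inv_inv, Perm.mul_apply]
  rw [← delta_plus_delta, delta_comp_self, perm_apply_inv]

theorem plus_snd (φ : Perm J) (k : Signed J) : (plus φ k).2 = k.2 := by
  obtain ⟨j, s⟩ := k
  rcases Int.units_eq_one_or s with rfl | rfl <;> simp

/-- From `φ₊ δ K⁻¹ = δ α φ₊`, the relation on the right at `k` is the one on the left at `φ₊ k`. -/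
theorem forall_label_iff {T : Type} (φ : Perm J) (α : Perm (Signed J)) (g : Signed J → T) :
    (∀ k, g k = g (delta J (α k))) ↔
      ∀ k, g (plus φ (delta J (delta J k))) = g (plus φ (delta J ((K φ α)⁻¹ k))) := by
  simp only [plus_delta_K_inv, delta_comp_self]
  exact (plus φ).forall_congr_right (q := fun k => g k = g (delta J (α k))) |>.symm

theorem forall_sign_label_iff (φ : Perm J) (α : Perm (Signed J)) (g : Signed J → ℤˣ) :
    (∀ k, k.2 * g k = (α k).2 * g (delta J (α k))) ↔
      ∀ k, k.2 * g (plus φ (delta J (delta J k))) =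
        ((K φ α)⁻¹ k).2 * g (plus φ (delta J ((K φ α)⁻¹ k))) := by
  have h : ∀ k, ((K φ α)⁻¹ k).2 = (α (plus φ k)).2 := fun k => by
    have := congrArg Prod.snd (plus_delta_K_inv φ α k)
    rw [plus_snd, delta_apply, delta_apply] at this
    simpa using this
  simp only [h, plus_delta_K_inv, delta_comp_self]
  rw [← (plus φ).forall_congr_right (q := fun k => k.2 * g k = (α k).2 * g (delta J (α k)))]
  simp only [plus_snd]

end Reindex

/-! ### Contractions -/

/-- Quaternionic conjugation is the adjugate of the 2×2 matrix. This is the source of all the signs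
attached to quaternion labels. -/
theorem entry_conjTranspose {N : ℕ} (A : QMat N) (i j : Fin N) (η θ : ℤˣ) :
    entry A.conjTranspose i j η θ = (((η * θ : ℤˣ) : ℤ) : ℂ) * entry A j i (-θ) (-η) := by
  rw [entry, entry, Matrix.conjTranspose_apply]
  rcases Int.units_eq_one_or η with rfl | rfl <;> rcases Int.units_eq_one_or θ with rfl | rfl <;>
    apply Complex.ext <;> simp [quatEntry]

theorem prod_ptInf {n : ℕ} {M : Type*} [CommMonoid M] (g : PtInf n → M) :
    ∏ j, g j = g ⊥ * ∏ k : Fin n, g (k : PtInf n) :=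
  Fintype.prod_option g

theorem signedMat_coe {n N : ℕ} (A : Fin n → QMat N) (k : Fin n) (s : ℤˣ) :
    signedMat A ((k : PtInf n), s) = starPow (A k) s := rfl

theorem signFD_bot {n : ℕ} (π : Perm (Signed (PtInf n))) : signFD π ⊥ = 1 :=
  if_pos (infPt_mem_FD π)

open Classical in
/-- The sum over labellings in the definition of `reTr`. -/
noncomputable def reTrSum {n N : ℕ} (π ρ : Perm (Signed (PtInf n))) (A : Fin n → QMat N)
    (a b : Fin N) (c d : ℤˣ) : ℂ :=
  ∑ i : Signed (PtInf n) → Fin N with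
      (∀ k, i (delta _ k) = i (ρ k)) ∧ i (infPt n) = a ∧ i (ρ (infPt n)) = b,
    ∑ h : FD π → ℤˣ with h (infFD π) = c ∧ h (nextFD π (infFD π)) = d,
      ∏ k : FD π with k ≠ infFD π,
        entry (signedMat A k) (i k) (i (ρ k)) (h k) (h (nextFD π k))

theorem reTr_eq {n N : ℕ} (π ρ : Perm (Signed (PtInf n))) (A : Fin n → QMat N)
    (a b : Fin N) (c d : ℤˣ) :
    reTr π ρ A a b c d = (2 : ℂ) ^ (-(((numCycles π / 2 : ℕ) : ℤ) - 1)) *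
      (N : ℂ) ^ (-(((numCycles ρ / 2 : ℕ) : ℤ) - 1)) * reTrSum π ρ A a b c d := rfl

section Contraction

variable {n N : ℕ}

open Classical in
-- Under `h = sgn · H`, the two quaternion indices at `k` become `sgn(k) H(k)` and `sgn(k) H(-k)`.
-- Where `FD π` contains the negative element, undoing the conjugate transpose restores the order of
-- the indices and leaves one factor of `selSign`.
theorem prod_FD_eq {π ρ : Perm (Signed (PtInf n))} (hπ : IsPM π) (A : Fin n → QMat N)
    {i : Signed (PtInf n) → Fin N} (hi : ∀ k, i (delta _ k) = i (ρ k))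
    {H : Signed (PtInf n) → ℤˣ} (hH : ∀ k, k.2 * H (delta _ k) = (π k).2 * H (π k)) :
    ∏ k : FD π with k ≠ infFD π, entry (signedMat A k) (i k) (i (ρ k)) (k.1.2 * H k)
        ((nextFD π k).1.2 * H (nextFD π k)) =
      (((selSign (signFD π) H : ℤˣ) : ℤ) : ℂ) *
        ∏ k : Fin n, entry (A k) (i ((k : PtInf n), 1)) (i ((k : PtInf n), -1))
          (H ((k : PtInf n), 1)) (H ((k : PtInf n), -1)) := by
  rw [selSign, prod_ptInf, signFD_bot, if_pos rfl, one_mul, Units.coe_prod, Int.cast_prod,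
    ← Finset.prod_mul_distrib]
  symm
  have hmem : ∀ k : Fin n, ((k : PtInf n), signFD π k) ∈ FD π := fun k => (mem_FD_iff hπ _).2 rfl
  refine Finset.prod_bij (fun k _ => ⟨((k : PtInf n), signFD π k), hmem k⟩) ?_ ?_ ?_ ?_
  · intro k _
    simp [infFD, Subtype.ext_iff]
  · intro k _ k' _ h
    exact WithBot.coe_injective (congrArg (fun k => k.1.1) h)
  · rintro ⟨⟨j, s⟩, hk⟩ hne
    have hs : s = signFD π j := (mem_FD_iff hπ _).1 hk
    cases j using WithBot.recBotCoe with
    | bot =>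
      rw [signFD_bot] at hs
      subst hs
      exact absurd rfl (Finset.mem_filter.1 hne).2
    | coe k => exact ⟨k, Finset.mem_univ _, by simp [hs]⟩
  · intro k _
    have h2 := hH ((k : PtInf n), signFD π k)
    simp only [nextFD]
    rw [← h2, ← hi]
    rcases Int.units_eq_one_or (signFD π k) with hs | hs
    · have : signedMat A ((k : PtInf n), 1) = A k :=
        (signedMat_coe A k 1).trans (if_pos rfl)
      simp [hs, this]
    · have : signedMat A ((k : PtInf n), -1) = (A k).conjTranspose :=
        (signedMat_coe A k (-1)).trans (if_neg (by decide))
      simp [hs, this, entry_conjTranspose, mul_comm]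

open Classical in
theorem sum_FD_eq {π : Perm (Signed (PtInf n))} (hπ : IsPM π) (c d : ℤˣ)
    (F : (Signed (PtInf n) → ℤˣ) → ℂ) (G : (FD π → ℤˣ) → ℂ)
    (hFG : ∀ H : Signed (PtInf n) → ℤˣ, (∀ k, k.2 * H (delta _ k) = (π k).2 * H (π k)) →
      F H = G fun k => k.1.2 * H k) :
    ∑ H : Signed (PtInf n) → ℤˣ with
        (∀ k, k.2 * H (delta _ k) = (π k).2 * H (π k)) ∧ H (infPt n) = c ∧
          H (delta _ (infPt n)) = d, F H =
      ∑ h : FD π → ℤˣ with h (infFD π) = c ∧ h (nextFD π (infFD π)) = d, G h := by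
  have hFD : ∀ k, k ∉ FD π → delta _ k ∈ FD π := fun k hk => (delta_mem_FD_iff hπ k).2 hk
  have hFD' : ∀ k, k ∈ FD π → delta _ k ∉ FD π := fun k hk h =>
    (delta_mem_FD_iff hπ k).1 h hk
  -- For `k` outside `FD π`, the constraint at `-k` reads `-sgn(k) H(k) = h(π(-k))`, which dictates
  -- the extension of `h`.
  refine Finset.sum_bij' (fun H _ k => k.1.2 * H k)
    (fun h _ k => if hk : k ∈ FD π then k.2 * h ⟨k, hk⟩ else
      k.2 * -h (nextFD π ⟨delta _ k, hFD k hk⟩)) ?_ ?_ ?_ ?_ ?_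
  · intro H hH
    simp only [Finset.mem_filter, Finset.mem_univ, true_and] at hH ⊢
    obtain ⟨h1, h2, h3⟩ := hH
    refine ⟨by simpa [infFD] using h2, ?_⟩
    simp only [nextFD, infFD]
    rw [← h1, h3]
    simp
  · intro h hh
    simp only [Finset.mem_filter, Finset.mem_univ, true_and] at hh ⊢
    obtain ⟨h1, h2⟩ := hh
    refine ⟨fun k => ?_, ?_, ?_⟩
    · by_cases hk : k ∈ FD π
      · rw [dif_neg (hFD' k hk), dif_pos (apply_mem_FD π hk)]
        simp only [delta_comp_self, nextFD]
        rw [delta_snd]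
        simp [← mul_assoc]
      · have hk' : π k ∉ FD π := fun h => hk (by
          simp only [FD, Finset.mem_filter, Finset.mem_univ, true_and,
            Perm.sameCycle_apply_left] at h ⊢
          exact h)
        rw [dif_pos (hFD k hk), dif_neg hk']
        simp only [nextFD, hπ.delta_apply_apply, ← mul_assoc, Int.units_mul_self, one_mul]
        rw [delta_snd]
        simp
    · rw [dif_pos (infPt_mem_FD π)]
      simpa [infFD] using h1
    · rw [dif_neg (hFD' _ (infPt_mem_FD π))]
      simp only [delta_comp_self]
      simpa [infFD] using h2
  · intro H hH
    simp only [Finset.mem_filter, Finset.mem_univ, true_and] at hH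
    funext k
    by_cases hk : k ∈ FD π
    · simp [hk, ← mul_assoc]
    · have := hH.1 (delta _ k)
      simp only [hk, dite_false, nextFD]
      rw [← this]
      simp [← mul_assoc]
  · intro h hh
    funext k
    simp [← mul_assoc]
  · intro H hH
    simp only [Finset.mem_filter, Finset.mem_univ, true_and] at hH
    exact hFG H hH.1

open Classical in
/-- The contraction over the labellings compatible with `δα` of the matrices `A k` inserted
between the indices `-k` and `φ(k)`. -/
theorem sum_label_eq {α : Perm (Signed (PtInf n))} (hα : IsPM α) (hinf : α (infPt n) = infPt n)
    {e : PtInf n → ℤˣ} (he : IsSelection α e) (φ ψ : Perm (PtInf n)) (A : Fin n → QMat N)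
    (a b : Fin N) (c d : ℤˣ) :
    ∑ I : Signed (PtInf n) → Fin N with
        (∀ k, I k = I (delta _ (α k))) ∧ I (infPt n) = a ∧ I (ψ ⊥, 1) = b,
      ∑ H : Signed (PtInf n) → ℤˣ with
          (∀ k, k.2 * H k = (α k).2 * H (delta _ (α k))) ∧ H (infPt n) = c ∧ H (φ ⊥, 1) = d,
        (((selSign e H : ℤˣ) : ℤ) : ℂ) * ∏ k : Fin n,
          entry (A k) (I ((k : PtInf n), -1)) (I (ψ k, 1)) (H ((k : PtInf n), -1)) (H (φ k, 1)) =
      (-1 : ℂ) ^ chi φ α * reTrSum (K φ α)⁻¹ (K ψ α)⁻¹ A a b c d := by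
  have hinfK : ∀ χ : Perm (PtInf n), plus χ (delta _ (infPt n)) = delta _ (infPt n) := fun χ => by
    simp
  rw [reTrSum, Finset.mul_sum]
  -- Matrix labels are transported by `ψ` and quaternion labels by `φ`. Only the latter carry signs,
  -- so only `chi φ α` enters the power of `-1`.
  refine Finset.sum_equiv
    (Equiv.arrowCongr (plus ψ * delta _)⁻¹ (Equiv.refl (Fin N))) ?_ ?_
  · intro I
    have hI : (Equiv.arrowCongr (plus ψ * delta _)⁻¹ (Equiv.refl (Fin N))) I =
        fun k => I (plus ψ (delta _ k)) := rfl
    rw [hI]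
    simp only [Finset.mem_filter, Finset.mem_univ, true_and]
    rw [forall_label_iff ψ]
    refine and_congr_right fun h => and_congr ?_ ?_
    · rw [hinfK]
      have := (forall_label_iff ψ α I).2 h (infPt n)
      rw [hinf] at this
      rw [← this]
    · rw [← h, delta_comp_self]
      rfl
  · intro I hI
    simp only [Finset.mem_filter, Finset.mem_univ, true_and] at hI
    have hI' : (Equiv.arrowCongr (plus ψ * delta _)⁻¹ (Equiv.refl (Fin N))) I =
        fun k => I (plus ψ (delta _ k)) := rfl
    rw [hI']
    set i : Signed (PtInf n) → Fin N := fun k => I (plus ψ (delta _ k)) with hidef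
    have hi : ∀ k, i (delta _ k) = i ((K ψ α)⁻¹ k) := (forall_label_iff ψ α I).1 hI.1
    have hπ := (hα.K φ).inv
    rw [← sum_FD_eq hπ c d (fun H => (((selSign (signFD (K φ α)⁻¹) H : ℤˣ) : ℤ) : ℂ) *
        ∏ k : Fin n, entry (A k) (i ((k : PtInf n), 1)) (i ((k : PtInf n), -1))
          (H ((k : PtInf n), 1)) (H ((k : PtInf n), -1))) _ fun H hH => (prod_FD_eq hπ A hi hH).symm]
    rw [Finset.mul_sum]
    refine Finset.sum_equiv
      (Equiv.arrowCongr (plus φ * delta _)⁻¹ (Equiv.refl ℤˣ)) ?_ ?_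
    · intro H
      have hH' : (Equiv.arrowCongr (plus φ * delta _)⁻¹ (Equiv.refl ℤˣ)) H =
        fun k => H (plus φ (delta _ k)) := rfl
      rw [hH']
      simp only [Finset.mem_filter, Finset.mem_univ, true_and]
      rw [forall_sign_label_iff φ]
      refine and_congr_right fun h => and_congr ?_ ?_
      · rw [hinfK]
        have := (forall_sign_label_iff φ α H).2 h (infPt n)
        rw [hinf] at this
        simp only [one_mul] at this
        rw [← this]
      · rw [delta_comp_self]
        rfl
    · intro H hH
      simp only [Finset.mem_filter, Finset.mem_univ, true_and] at hH
      have hH' : (Equiv.arrowCongr (plus φ * delta _)⁻¹ (Equiv.refl ℤˣ)) H =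
        fun k => H (plus φ (delta _ k)) := rfl
      rw [hH', selSign_relation (φ := φ) hα he hH.1]
      simp only [hidef, delta_apply, neg_neg, plus_pos, plus_neg]
      push_cast
      rw [← mul_assoc]
      congr 2
      rcases Int.even_or_odd (chi φ α) with h | h
      · rw [h.neg_one_zpow, h.neg_one_zpow]; simp
      · rw [h.neg_one_zpow, h.neg_one_zpow]; simp

end Contraction

/-! ### Products over colours -/

theorem list_prod_apply_eq_self {S : Type} (L : List (Perm S)) (x : S)
    (h : ∀ σ ∈ L, σ x = x) : L.prod x = x := by
  induction L with
  | nil => rfl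
  | cons σ L ih =>
    rw [List.prod_cons, Perm.mul_apply, ih fun τ hτ => h τ (List.mem_cons_of_mem _ hτ),
      h σ List.mem_cons_self]

theorem list_prod_map_apply {S T : Type} {L : List T} (hL : L.Nodup) {c : T} (hc : c ∈ L)
    (g : T → Perm S) {x y : S} (hxy : g c x = y) (hx : ∀ t, t ≠ c → g t x = x)
    (hy : ∀ t, t ≠ c → g t y = y) : (L.map g).prod x = y := by
  induction L with
  | nil => simp at hc
  | cons t L ih =>
    rw [List.nodup_cons] at hL
    rw [List.map_cons, List.prod_cons, Perm.mul_apply]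
    rcases List.mem_cons.1 hc with rfl | hc
    · rw [list_prod_apply_eq_self, hxy]
      intro σ hσ
      obtain ⟨t, ht, rfl⟩ := List.mem_map.1 hσ
      exact hx t fun h => hL.1 (h ▸ ht)
    · rw [ih hL.2 hc, hy]
      rintro rfl
      exact hL.1 hc

section Colours

variable {n C : ℕ} {w : Fin n → Fin C}

theorem mem_colourClass {c : Fin C} {k : Fin n} : k ∈ colourClass w c ↔ w k = c := by
  simp [colourClass]

/-- `k` as an element of its colour class. -/
def inColour (w : Fin n → Fin C) (k : Fin n) : colourClass w (w k) := ⟨k, mem_colourClass.2 rfl⟩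

theorem inclInf_apply (I : Finset (Fin n)) (x : Signed I) :
    inclInf I x = (((x.1 : Fin n) : PtInf n), x.2) := rfl

theorem inclInf_delta (I : Finset (Fin n)) (x : Signed I) :
    inclInf I (delta _ x) = delta _ (inclInf I x) := by
  simp [inclInf_apply]

theorem notMem_range_inclInf {c c' : Fin C} (h : c ≠ c') (x : Signed (colourClass w c')) :
    inclInf (colourClass w c') x ∉ Set.range (inclInf (colourClass w c)) := by
  rintro ⟨y, hy⟩
  have h1 : (y.1 : Fin n) = x.1 := WithBot.coe_injective (congrArg Prod.fst hy)
  exact h ((mem_colourClass.1 y.1.2).symm.trans (h1 ▸ mem_colourClass.1 x.1.2))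

theorem bot_notMem_range_inclInf (I : Finset (Fin n)) (s : ℤˣ) :
    ((⊥, s) : Signed (PtInf n)) ∉ Set.range (inclInf I) := by
  rintro ⟨y, hy⟩
  exact WithBot.coe_ne_bot (congrArg Prod.fst hy)

theorem forall_signed_iff (w : Fin n → Fin C) {Q : Signed (PtInf n) → Prop} :
    (∀ k, Q k) ↔ (∀ s, Q (⊥, s)) ∧
      ∀ c (x : Signed (colourClass w c)), Q (inclInf _ x) := by
  refine ⟨fun h => ⟨fun s => h _, fun c x => h _⟩, fun ⟨h1, h2⟩ => ?_⟩
  rintro ⟨j, s⟩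
  cases j using WithBot.recBotCoe with
  | bot => exact h1 s
  | coe k => exact h2 (w k) (inColour w k, s)

variable (α : ∀ c, PM (colourClass w c))

theorem prodPerm_bot (s : ℤˣ) : prodPerm w α (⊥, s) = (⊥, s) := by
  apply list_prod_apply_eq_self
  intro σ hσ
  obtain ⟨c, -, rfl⟩ := List.mem_map.1 hσ
  exact Perm.viaEmbedding_apply_of_notMem _ _ _ (bot_notMem_range_inclInf _ s)

theorem prodPerm_inclInf (c : Fin C) (x : Signed (colourClass w c)) :
    prodPerm w α (inclInf _ x) = inclInf _ ((α c).1 x) :=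
  list_prod_map_apply (List.nodup_finRange C) (List.mem_finRange c) _
    (Perm.viaEmbedding_apply _ _ _)
    (fun _ ht => Perm.viaEmbedding_apply_of_notMem _ _ _ (notMem_range_inclInf ht x))
    (fun _ ht => Perm.viaEmbedding_apply_of_notMem _ _ _ (notMem_range_inclInf ht _))

theorem isPM_prodPerm : IsPM (prodPerm w α) := by
  refine isPM_of_apply ((forall_signed_iff w).2 ⟨fun s => ?_, fun c x => ?_⟩)
    ((forall_signed_iff w).2 ⟨fun s h => ?_, fun c x h => ?_⟩)
  · rw [prodPerm_bot, delta_apply, prodPerm_bot]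
  · rw [prodPerm_inclInf, ← inclInf_delta, prodPerm_inclInf, (α c).2.delta_apply_apply,
      inclInf_delta]
  · rw [prodPerm_bot] at h
    exact delta_ne _ h.symm
  · rw [prodPerm_inclInf, ← inclInf_delta] at h
    exact (α c).2.apply_ne x ((inclInf _).injective h)

/-- The signs of the union of the sets `FD(α_c)` and `{∞}`. -/
noncomputable def colourSign : PtInf n → ℤˣ
  | none => 1
  | some k => signFD (α (w k)).1 (inColour w k)

theorem colourSign_coe (c : Fin C) (x : colourClass w c) :
    colourSign α ((x : Fin n) : PtInf n) = signFD (α c).1 x := by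
  obtain ⟨x, hx⟩ := x
  obtain rfl := mem_colourClass.1 hx
  rfl

theorem isSelection_prodPerm : IsSelection (prodPerm w α) (colourSign α) := by
  refine (forall_signed_iff w).2 ⟨fun s h => ?_, fun c x h => ?_⟩
  · rwa [prodPerm_bot]
  · rw [prodPerm_inclInf, inclInf_apply, colourSign_coe]
    rw [inclInf_apply, colourSign_coe] at h
    exact isSelection_signFD (α c).2 x h

/-- The summand 2 counts the fixed points `∞` and `-∞`. -/
theorem numCycles_prodPerm : numCycles (prodPerm w α) = 2 + ∑ c, numCycles (α c).1 := by
  let R : Option (Fin C) → Type := fun t => t.elim ℤˣ fun c => Signed (colourClass w c)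
  have : ∀ t, Finite (R t) := by
    rintro (_ | c)
    · exact inferInstanceAs (Finite ℤˣ)
    · exact inferInstanceAs (Finite (Signed (colourClass w c)))
  let E : (Σ t, R t) → Signed (PtInf n)
    | ⟨none, s⟩ => (⊥, s)
    | ⟨some c, x⟩ => inclInf (colourClass w c) x
  have hE : Function.Bijective E := by
    constructor
    · rintro ⟨_ | c, x⟩ ⟨_ | c', x'⟩ h
      · exact congrArg (Sigma.mk none) (congrArg Prod.snd h)
      · exact absurd ⟨x', h.symm⟩ (bot_notMem_range_inclInf _ _)
      · exact absurd ⟨x, h⟩ (bot_notMem_range_inclInf _ _)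
      · by_cases hc : c = c'
        · subst hc
          rw [(inclInf _).injective h]
        · exact absurd ⟨x, h⟩ (notMem_range_inclInf hc x')
    · exact (forall_signed_iff w).2 ⟨fun s => ⟨⟨none, s⟩, rfl⟩, fun c x => ⟨⟨some c, x⟩, rfl⟩⟩
  let σ : ∀ t, Perm (R t)
    | none => (1 : Perm ℤˣ)
    | some c => (α c).1
  rw [numCycles_eq_sum (Equiv.ofBijective E hE) (prodPerm w α) σ ?_, Fintype.sum_option]
  · congr 1
    show Nat.card (Quotient (Perm.SameCycle.setoid (1 : Perm ℤˣ))) = 2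
    have hbij : Function.Bijective
        (Quotient.mk (Perm.SameCycle.setoid (1 : Perm ℤˣ))) :=
      ⟨fun x y hxy => Perm.sameCycle_one.1 (Quotient.exact hxy), Quotient.mk_surjective⟩
    rw [← Nat.card_eq_of_bijective _ hbij]
    simp
  · rintro (_ | c) x
    · exact prodPerm_bot α x
    · exact prodPerm_inclInf α c x

variable (ε : Fin n → ℤˣ)

theorem isPM_twist_prodPerm : IsPM (twist ε (prodPerm w α)) := isPM_twist (isPM_prodPerm α) _

theorem twist_prodPerm_inf : twist ε (prodPerm w α) (infPt n) = infPt n := by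
  have h : ∀ s, flip (extSign ε) (⊥, s) = (⊥, s) := fun s => Prod.ext rfl (one_mul s)
  rw [twist, Perm.mul_apply, Perm.mul_apply, h, prodPerm_bot, h]

theorem isSelection_twist {π : Perm (Signed (PtInf n))} {e : PtInf n → ℤˣ}
    (h : IsSelection π e) : IsSelection (twist ε π) fun j => extSign ε j * e j := by
  intro k hk
  have := h (flip (extSign ε) k) (by simp [hk, ← mul_assoc])
  simp only [twist, Perm.mul_apply]
  rw [flip_apply, this]

theorem numCycles_twist (π : Perm (Signed (PtInf n))) : numCycles (twist ε π) = numCycles π := by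
  rw [twist]
  conv_lhs => rw [← flip_inv (extSign ε), flip_inv, ← flip_inv (extSign ε)]
  have := numCycles_conj π (flip (extSign ε))
  simpa only [flip_inv] using this

theorem numCycles_twist_prodPerm_div_two :
    numCycles (twist ε (prodPerm w α)) / 2 = 1 + ∑ c, numCycles (α c).1 / 2 := by
  rw [numCycles_twist, numCycles_prodPerm]
  have : ∑ c, numCycles (α c).1 = 2 * ∑ c, numCycles (α c).1 / 2 := by
    rw [Finset.mul_sum]
    exact Finset.sum_congr rfl fun c _ => (even_numCycles (α c).2).symm
  omega

/-- Two functions `g`, `g'` are allowed so that one statement covers both constraints: `g' = g` for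
matrix labels, and `g = sgn · H`, `g' = -sgn · H` for quaternion labels. The hypothesis `hg` is the
constraint at `±∞`, which are fixed. -/
theorem forall_twist_iff {T : Type} {g : Signed (PtInf n) → T} {g' : Signed (PtInf n) → T}
    (hg : ∀ s, g (⊥, s) = g' (⊥, -s)) :
    (∀ k, g k = g' (delta _ (twist ε (prodPerm w α) k))) ↔
      ∀ c (x : Signed (colourClass w c)), g (flip (extSign ε) (inclInf _ x)) =
        g' (flip (extSign ε) (inclInf _ (delta _ ((α c).1 x)))) := by
  rw [← (flip (extSign ε)).forall_congr_right, forall_signed_iff w]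
  have h1 : ∀ k, delta _ (twist ε (prodPerm w α) (flip (extSign ε) k)) =
      flip (extSign ε) (delta _ (prodPerm w α k)) := fun k => by
    simp only [twist, Perm.mul_apply, flip_apply, delta_apply, ← mul_assoc, Int.units_mul_self,
      one_mul, mul_neg]
  simp only [h1, prodPerm_inclInf, inclInf_delta]
  refine and_iff_right fun s => ?_
  have h : ∀ s, flip (extSign ε) (⊥, s) = (⊥, s) := fun s => Prod.ext rfl (one_mul s)
  rw [prodPerm_bot, delta_apply, h, h, hg]

end Colours

/-! ### Entries -/

section Entries

variable {n N : ℕ}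

theorem sum_units {M : Type*} [AddCommMonoid M] (g : ℤˣ → M) : ∑ s, g s = g 1 + g (-1) := by
  rw [show (Finset.univ : Finset ℤˣ) = {1, -1} from rfl, Finset.sum_pair (by decide)]

theorem quatEntry_mul (p q : Quaternion ℝ) (η θ : ℤˣ) :
    quatEntry (p * q) η θ = ∑ κ, quatEntry p η κ * quatEntry q κ θ := by
  rw [sum_units]
  rcases Int.units_eq_one_or η with rfl | rfl <;> rcases Int.units_eq_one_or θ with rfl | rfl <;>
    apply Complex.ext <;> simp [quatEntry] <;> ring

theorem quatEntry_add (p q : Quaternion ℝ) (η θ : ℤˣ) :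
    quatEntry (p + q) η θ = quatEntry p η θ + quatEntry q η θ := by
  rcases Int.units_eq_one_or η with rfl | rfl <;> rcases Int.units_eq_one_or θ with rfl | rfl <;>
    apply Complex.ext <;> simp [quatEntry] <;> ring

theorem quatEntry_zero (η θ : ℤˣ) : quatEntry 0 η θ = 0 := by
  rcases Int.units_eq_one_or η with rfl | rfl <;> rcases Int.units_eq_one_or θ with rfl | rfl <;>
    apply Complex.ext <;> simp [quatEntry] <;> rfl

theorem entry_mul (A B : QMat N) (i j : Fin N) (η θ : ℤˣ) :
    entry (A * B) i j η θ = ∑ l, ∑ κ, entry A i l η κ * entry B l j κ θ := by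
  let f : Quaternion ℝ →+ ℂ := ⟨⟨fun q => quatEntry q η θ, quatEntry_zero η θ⟩,
    fun p q => quatEntry_add p q η θ⟩
  have : entry (A * B) i j η θ = f ((A * B) i j) := rfl
  rw [this, Matrix.mul_apply, map_sum]
  exact Finset.sum_congr rfl fun l _ => quatEntry_mul _ _ _ _

theorem entry_starPow (A : QMat N) (s : ℤˣ) (I : ℤˣ → Fin N) (H : ℤˣ → ℤˣ) :
    entry (starPow A s) (I 1) (I (-1)) (H 1) (H (-1)) =
      (((if s = 1 then 1 else H 1 * H (-1) : ℤˣ) : ℤ) : ℂ) *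
        entry A (I s) (I (-s)) (s * H s) (s * H (-s)) := by
  rcases Int.units_eq_one_or s with rfl | rfl
  · simp [starPow]
  · simp [starPow, entry_conjTranspose]

/-- The labelling of `±[n]_∞` that agrees with `I` on the positive elements and at `±∞`, and
with `l` on the other negative elements. -/
def glue {T : Type} (I : Signed (PtInf n) → T) (l : Fin n → T) : Signed (PtInf n) → T
  | (none, _) => I (⊥, 1)
  | (some k, s) => if s = 1 then I ((k : PtInf n), 1) else l k

theorem glue_pos {T : Type} (I : Signed (PtInf n) → T) (l : Fin n → T) (j : PtInf n) :
    glue I l (j, 1) = I (j, 1) := by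
  cases j using WithBot.recBotCoe <;> rfl

theorem glue_neg {T : Type} (I : Signed (PtInf n) → T) (l : Fin n → T) (k : Fin n) :
    glue I l ((k : PtInf n), -1) = l k := rfl

open Classical in
theorem sum_glue {T : Type} [Fintype T] [DecidableEq T] (ψ : Perm (PtInf n)) (a b : T)
    (F : (Signed (PtInf n) → T) → ℂ) :
    ∑ I : Signed (PtInf n) → T with
        I (⊥, 1) = I (⊥, -1) ∧ I (infPt n) = a ∧ I (ψ ⊥, 1) = b, F I =
      ∑ I : Signed (PtInf n) → T with
        (∀ k, I k = I (delta _ k)) ∧ I (infPt n) = a ∧ I (ψ ⊥, 1) = b,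
        ∑ l : Fin n → T, F (glue I l) := by
  rw [Finset.sum_sigma']
  symm
  refine Finset.sum_bij' (fun p _ => glue p.1 p.2)
    (fun I _ => ⟨fun k => I (k.1, 1), fun k => I ((k : PtInf n), -1)⟩) ?_ ?_ ?_ ?_ ?_
  · rintro ⟨I, l⟩ h
    simp only [Finset.mem_sigma, Finset.mem_filter, Finset.mem_univ, true_and, and_true] at h ⊢
    refine ⟨rfl, ?_, ?_⟩
    · rw [glue_pos]; exact h.2.1
    · rw [glue_pos]; exact h.2.2
  · intro I h
    simp only [Finset.mem_sigma, Finset.mem_filter, Finset.mem_univ, true_and, and_true] at h ⊢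
    exact ⟨fun k => by simp, h.2⟩
  · rintro ⟨I, l⟩ h
    simp only [Finset.mem_sigma, Finset.mem_filter, Finset.mem_univ, true_and, and_true] at h
    refine Sigma.ext ?_ ?_
    · refine signed_ext (fun j => glue_pos _ _ _) fun j => ?_
      have := h.1 (j, 1)
      simp only [delta_apply] at this
      exact (glue_pos _ _ _).trans this
    · exact heq_of_eq (funext fun k => glue_neg I l k)
  · intro I h
    simp only [Finset.mem_filter, Finset.mem_univ, true_and] at h
    refine signed_ext (fun j => glue_pos _ _ _) fun j => ?_
    cases j using WithBot.recBotCoe with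
    | bot => exact h.1
    | coe k => exact glue_neg _ _ _
  · intro _ _; rfl

theorem prod_sum_sum {T T' : Type} [Fintype T] [Fintype T'] (g : Fin n → T → T' → ℂ) :
    ∏ k, ∑ x, ∑ y, g k x y = ∑ l : Fin n → T, ∑ m : Fin n → T', ∏ k, g k (l k) (m k) := by
  rw [Finset.prod_univ_sum, Fintype.piFinset_univ]
  refine Finset.sum_congr rfl fun l _ => ?_
  rw [Finset.prod_univ_sum, Fintype.piFinset_univ]

open Classical in
-- This is `sum_label_eq` at `α = 1`, because `K(φ, 1)⁻¹ = φ₊φ₋⁻¹`.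
theorem reTrSum_double_eq (φ ψ : Perm (PtInf n)) (A : Fin n → QMat N) (a b : Fin N) (c d : ℤˣ) :
    reTrSum (double φ) (double ψ) A a b c d =
      ∑ I : Signed (PtInf n) → Fin N with
          (∀ k, I k = I (delta _ k)) ∧ I (infPt n) = a ∧ I (ψ ⊥, 1) = b,
        ∑ H : Signed (PtInf n) → ℤˣ with
            (∀ k, H k = H (delta _ k)) ∧ H (infPt n) = c ∧ H (φ ⊥, 1) = d,
          ∏ k : Fin n, entry (A k) (I ((k : PtInf n), 1)) (I (ψ k, 1)) (H ((k : PtInf n), 1))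
            (H (φ k, 1)) := by
  have hsel : IsSelection (1 : Perm (Signed (PtInf n))) fun _ => 1 := fun k hk => hk
  have h := sum_label_eq isPM_one rfl hsel φ ψ A a b c d
  -- Testing the sign relation on the constant labelling 1, where both selection signs are 1, gives
  -- the parity without counting cycles.
  have hχ : (-1 : ℤˣ) ^ chi φ (1 : Perm (Signed (PtInf n))) = 1 := by
    have := selSign_relation (φ := φ) isPM_one hsel (H := fun _ => 1) fun k => rfl
    simpa [selSign] using this.symm
  have hχ' : (-1 : ℂ) ^ chi φ (1 : Perm (Signed (PtInf n))) = 1 := by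
    rcases Int.even_or_odd (chi φ (1 : Perm (Signed (PtInf n)))) with h | h
    · exact h.neg_one_zpow
    · rw [h.neg_one_zpow] at hχ
      exact absurd hχ (by decide)
  rw [hχ', one_mul, ← double_eq_K_one, ← double_eq_K_one] at h
  rw [← h]
  refine Finset.sum_congr rfl fun I hI => ?_
  simp only [Finset.mem_filter, Finset.mem_univ, true_and] at hI
  have hS : ∀ H : Signed (PtInf n) → ℤˣ,
      (∀ k : Signed (PtInf n), k.2 * H k = ((1 : Perm (Signed (PtInf n))) k).2 *
        H (delta _ ((1 : Perm (Signed (PtInf n))) k))) ↔ ∀ k, H k = H (delta _ k) := fun H => by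
    simp only [Perm.one_apply, mul_right_inj]
  simp only [hS]
  refine Finset.sum_congr rfl fun H hH => ?_
  simp only [Finset.mem_filter, Finset.mem_univ, true_and] at hH
  have h1 : ∀ j, I (j, -1) = I (j, 1) := fun j => by simpa using hI.1 (j, -1)
  have h2 : ∀ j, H (j, -1) = H (j, 1) := fun j => by simpa using hH.1 (j, -1)
  simp [selSign, h1, h2]

open Classical in
theorem reTrSum_double_mul (φ ψ : Perm (PtInf n)) (A B : Fin n → QMat N)
    (a b : Fin N) (c d : ℤˣ) :
    reTrSum (double φ) (double ψ) (fun k => A k * B k) a b c d =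
      ∑ I : Signed (PtInf n) → Fin N with
          I (⊥, 1) = I (⊥, -1) ∧ I (infPt n) = a ∧ I (ψ ⊥, 1) = b,
        ∑ H : Signed (PtInf n) → ℤˣ with
            H (⊥, 1) = H (⊥, -1) ∧ H (infPt n) = c ∧ H (φ ⊥, 1) = d,
          (∏ k : Fin n, entry (A k) (I ((k : PtInf n), 1)) (I ((k : PtInf n), -1))
            (H ((k : PtInf n), 1)) (H ((k : PtInf n), -1))) *
          ∏ k : Fin n, entry (B k) (I ((k : PtInf n), -1)) (I (ψ k, 1)) (H ((k : PtInf n), -1))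
            (H (φ k, 1)) := by
  rw [reTrSum_double_eq, sum_glue]
  refine Finset.sum_congr rfl fun I _ => ?_
  simp only [sum_glue φ]
  rw [Finset.sum_comm]
  refine Finset.sum_congr rfl fun H _ => ?_
  simp only [entry_mul, prod_sum_sum, ← Finset.prod_mul_distrib, glue_pos, glue_neg]

end Entries

/-! ### Moments -/

section Moments

variable {n N C : ℕ}

theorem measurable_quatEntry (η θ : ℤˣ) : Measurable fun q : Quaternion ℝ => quatEntry q η θ := by
  have h : ∀ q : Quaternion ℝ, quatEntry q η θ =
      if η = 1 then if θ = 1 then (q.re : ℂ) + q.imI * Complex.I else q.imJ + q.imK * Complex.I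
      else if θ = 1 then -(q.imJ : ℂ) + q.imK * Complex.I else q.re - q.imI * Complex.I := fun q => by
    unfold quatEntry
    split_ifs <;> apply Complex.ext <;> simp
  simp only [h]
  have h1 := Complex.continuous_ofReal.comp Quaternion.continuous_re
  have h2 := Complex.continuous_ofReal.comp Quaternion.continuous_imI
  have h3 := Complex.continuous_ofReal.comp Quaternion.continuous_imJ
  have h4 := Complex.continuous_ofReal.comp Quaternion.continuous_imK
  apply Continuous.measurable
  split_ifs
  · exact h1.add (h2.mul_const _)
  · exact h3.add (h4.mul_const _)
  · exact h3.neg.add (h4.mul_const _)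
  · exact h1.sub (h2.mul_const _)

theorem measurable_entry (i j : Fin N) (η θ : ℤˣ) :
    Measurable fun A : QMat N => entry A i j η θ :=
  (measurable_quatEntry η θ).comp ((measurable_pi_apply j).comp (measurable_pi_apply i))

theorem measurable_starPow (s : ℤˣ) (i j : Fin N) (η θ : ℤˣ) :
    Measurable fun A : QMat N => entry (starPow A s) i j η θ := by
  rcases Int.units_eq_one_or s with rfl | rfl
  · exact measurable_entry i j η θ
  · have : (fun A : QMat N => entry (starPow A (-1)) i j η θ) =
        fun A => (((η * θ : ℤˣ) : ℤ) : ℂ) * entry A j i (-θ) (-η) :=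
      funext fun A => entry_conjTranspose A i j η θ
    rw [this]
    exact (measurable_entry _ _ _ _).const_mul _

/-- The norm is multiplicative, so the integral of the norm of the product factors over the
independent family. -/
theorem integrable_prod_of_iIndepFun {Ω ι : Type*} [MeasurableSpace Ω] {μ : Measure Ω} [Fintype ι]
    {G : ι → Ω → ℂ} (hG : iIndepFun G μ) (hm : ∀ c, Measurable (G c))
    (hi : ∀ c, Integrable (G c) μ) : Integrable (fun ω => ∏ c, G c ω) μ := by
  refine ⟨(Finset.measurable_fun_prod _ fun c _ => hm c).aestronglyMeasurable, ?_⟩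
  have h1 : iIndepFun (fun c ω => ‖G c ω‖ₑ) μ := hG.comp (fun _ z => ‖z‖ₑ) fun _ => measurable_enorm
  have h2 := lintegral_prod_eq_prod_lintegral_of_indepFun Finset.univ _ h1 fun c => (hm c).enorm
  have h3 : ∀ ω, ‖∏ c, G c ω‖ₑ = ∏ c, ‖G c ω‖ₑ := fun ω => by
    simp only [← ofReal_norm, norm_prod]
    rw [ENNReal.ofReal_prod_of_nonneg fun _ _ => norm_nonneg _]
  rw [HasFiniteIntegral]
  simp only [h3]
  rw [h2]
  exact ENNReal.prod_lt_top fun c _ => (hi c).2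

theorem prod_colourClass {M : Type*} [CommMonoid M] (w : Fin n → Fin C) (g : Fin n → M) :
    ∏ k, g k = ∏ c, ∏ x : colourClass w c, g x := by
  rw [← Finset.prod_fiberwise (s := Finset.univ) (g := w)]
  exact Finset.prod_congr rfl fun c _ => (Finset.prod_coe_sort (colourClass w c) g).symm

/-- Conjugate transposes contribute `H(k)H(-k)` where `ε(k) = -1`, and the moment expansion where
`-k` lies in its fundamental domain. Where both occur they cancel, which leaves the twisted
selection. -/
theorem prod_sign_eq (w : Fin n → Fin C) (ε : Fin n → ℤˣ) (α : ∀ c, PM (colourClass w c))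
    (H : Signed (PtInf n) → ℤˣ) :
    (((selSign (fun j => extSign ε j * colourSign α j) H : ℤˣ) : ℤ) : ℂ) =
      (∏ k : Fin n, (((if ε k = 1 then 1 else H ((k : PtInf n), 1) * H ((k : PtInf n), -1) : ℤˣ) :
        ℤ) : ℂ)) * ∏ c, ∏ x : colourClass w c, if ((x, -1) : Signed (colourClass w c)) ∈ FD (α c).1
          then (((H (((x : Fin n) : PtInf n), 1) * H (((x : Fin n) : PtInf n), -1) : ℤˣ) : ℤ) : ℂ)
          else 1 := by
  have hbot : extSign ε ⊥ * colourSign α ⊥ = 1 := rfl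
  rw [selSign, prod_ptInf, hbot, if_pos rfl, one_mul, Units.coe_prod, Int.cast_prod,
    prod_colourClass w, prod_colourClass w, ← Finset.prod_mul_distrib]
  refine Finset.prod_congr rfl fun c _ => ?_
  rw [← Finset.prod_mul_distrib]
  refine Finset.prod_congr rfl fun x _ => ?_
  have hε : extSign ε ((x : Fin n) : PtInf n) = ε x := rfl
  simp only [hε, colourSign_coe, mem_FD_iff (α c).2]
  generalize H (((x : Fin n) : PtInf n), 1) = p
  generalize H (((x : Fin n) : PtInf n), -1) = q
  rcases Int.units_eq_one_or (ε x) with h | h <;>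
    rcases Int.units_eq_one_or (signFD (α c).1 x) with h' | h' <;>
    rcases Int.units_eq_one_or p with rfl | rfl <;>
    rcases Int.units_eq_one_or q with rfl | rfl <;> simp [h, h']

open Classical in
theorem integral_prod_starPow {Ω : Type*} [MeasurableSpace Ω] (μ : Measure Ω)
    (X : Fin C → Fin n → Ω → QMat N) (w : Fin n → Fin C)
    (hXmeas : ∀ c k, Measurable (X c k)) (hXindep : iIndepFun (fun c ω k => X c k ω) μ)
    (f : ∀ (_ : Fin C) (I : Finset (Fin n)), PM I → ℂ)
    (hf : ∀ c I, HasMomentExpansion μ (X c) I (f c I)) (ε : Fin n → ℤˣ)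
    (I : Signed (PtInf n) → Fin N) (H : Signed (PtInf n) → ℤˣ)
    (hI : I (⊥, 1) = I (⊥, -1)) (hH : H (⊥, 1) = H (⊥, -1)) :
    Integrable (fun ω => ∏ k : Fin n, entry (starPow (X (w k) k ω) (ε k)) (I ((k : PtInf n), 1))
      (I ((k : PtInf n), -1)) (H ((k : PtInf n), 1)) (H ((k : PtInf n), -1))) μ ∧
    ∫ ω, ∏ k : Fin n, entry (starPow (X (w k) k ω) (ε k)) (I ((k : PtInf n), 1))
      (I ((k : PtInf n), -1)) (H ((k : PtInf n), 1)) (H ((k : PtInf n), -1)) ∂μ =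
    ∑ α : ∀ c, PM (colourClass w c),
      if (∀ k, I k = I (delta _ (twist ε (prodPerm w α) k))) ∧
          (∀ k, k.2 * H k = (twist ε (prodPerm w α) k).2 *
            H (delta _ (twist ε (prodPerm w α) k))) then
        (((selSign (fun j => extSign ε j * colourSign α j) H : ℤˣ) : ℤ) : ℂ) *
          ∏ c, ((2 * (N : ℂ)) ^ (((numCycles (α c).1 / 2 : ℕ) : ℤ) - ((colourClass w c).card : ℤ)) *
            f c (colourClass w c) (α c))
      else 0 := by
  -- `ι` and `η` are the labels seen by the unstarred `X_k`: an adjoint exchanges the labels at `±k`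
  -- and negates the quaternion ones.
  set ι : Signed (PtInf n) → Fin N := fun k => I (flip (extSign ε) k) with hι
  set η : Signed (PtInf n) → ℤˣ := fun k => extSign ε k.1 * H (flip (extSign ε) k) with hη
  set s0 : ℂ := ∏ k : Fin n, (((if ε k = 1 then 1 else
    H ((k : PtInf n), 1) * H ((k : PtInf n), -1) : ℤˣ) : ℤ) : ℂ) with hs0
  let g : ∀ c, (Fin n → QMat N) → ℂ := fun c A => ∏ x : colourClass w c,
    entry (A x) (ι (inclInf _ (x, 1))) (ι (inclInf _ (x, -1)))
      (η (inclInf _ (x, 1))) (η (inclInf _ (x, -1)))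
  have hg : ∀ c, Measurable (g c) := fun c =>
    Finset.measurable_fun_prod _ fun x _ => (measurable_entry _ _ _ _).comp (measurable_pi_apply _)
  have hpt : ∀ ω, ∏ k : Fin n, entry (starPow (X (w k) k ω) (ε k)) (I ((k : PtInf n), 1))
      (I ((k : PtInf n), -1)) (H ((k : PtInf n), 1)) (H ((k : PtInf n), -1)) =
      s0 * ∏ c, g c (fun k => X c k ω) := fun ω => by
    have h1 : ∏ c, g c (fun k => X c k ω) = ∏ k : Fin n, entry (X (w k) k ω)
        (ι ((k : PtInf n), 1)) (ι ((k : PtInf n), -1)) (η ((k : PtInf n), 1))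
        (η ((k : PtInf n), -1)) := by
      rw [prod_colourClass w]
      refine Finset.prod_congr rfl fun c _ => Finset.prod_congr rfl fun x _ => ?_
      rw [mem_colourClass.1 x.2]
      rfl
    rw [h1, hs0, ← Finset.prod_mul_distrib]
    refine Finset.prod_congr rfl fun k _ => ?_
    have h2 := entry_starPow (X (w k) k ω) (ε k) (fun s => I ((k : PtInf n), s))
      (fun s => H ((k : PtInf n), s))
    have h3 : extSign ε (k : PtInf n) = ε k := rfl
    simpa only [hι, hη, flip_apply, h3, mul_one, mul_neg] using h2
  have hmom := fun c => hf c (colourClass w c) (fun x => ι (inclInf _ x)) (fun x => η (inclInf _ x))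
  have hint : ∀ c, Integrable (fun ω => g c fun k => X c k ω) μ := fun c => (hmom c).1
  have hmeas : ∀ c, Measurable fun ω => g c fun k => X c k ω := fun c =>
    (hg c).comp (measurable_pi_lambda _ fun k => hXmeas c k)
  have hind : iIndepFun (fun c ω => g c fun k => X c k ω) μ := hXindep.comp g hg
  simp only [hpt]
  refine ⟨(integrable_prod_of_iIndepFun hind hmeas hint).const_mul _, ?_⟩
  rw [integral_const_mul, hind.integral_fun_prod_eq_prod_integral fun c =>
    (hmeas c).aestronglyMeasurable]
  rw [Finset.prod_congr rfl fun c _ => (hmom c).2]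
  simp only [Finset.sum_filter]
  rw [Finset.prod_univ_sum, Fintype.piFinset_univ, Finset.mul_sum]
  refine Finset.sum_congr rfl fun α _ => ?_
  rw [Finset.prod_ite_zero]
  have hcond : (∀ c ∈ Finset.univ, (∀ k, ι (inclInf _ k) = ι (inclInf _ (delta _ ((α c).1 k)))) ∧
        ∀ k, k.2 * η (inclInf _ k) = ((α c).1 k).2 * η (inclInf _ (delta _ ((α c).1 k)))) ↔
      (∀ k, I k = I (delta _ (twist ε (prodPerm w α) k))) ∧
          (∀ k, k.2 * H k = (twist ε (prodPerm w α) k).2 *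
            H (delta _ (twist ε (prodPerm w α) k))) := by
    rw [forall_twist_iff α ε (g := I) (g' := I) fun s => by
      rcases Int.units_eq_one_or s with rfl | rfl
      · exact hI
      · rw [neg_neg]; exact hI.symm]
    have h1 : (∀ k, k.2 * H k = (twist ε (prodPerm w α) k).2 *
        H (delta _ (twist ε (prodPerm w α) k))) ↔
        ∀ k, (fun k : Signed (PtInf n) => k.2 * H k) k =
          (fun k : Signed (PtInf n) => -k.2 * H k) (delta _ (twist ε (prodPerm w α) k)) := by
      simp
    rw [h1, forall_twist_iff α ε (g := fun k => k.2 * H k) (g' := fun k => -k.2 * H k) fun s => by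
      rcases Int.units_eq_one_or s with rfl | rfl
      · simpa using hH
      · simpa using hH.symm]
    simp only [Finset.mem_univ, forall_const, forall_and]
    refine and_congr Iff.rfl (forall_congr' fun c => forall_congr' fun k => ?_)
    simp only [hη, flip_apply, inclInf_apply, delta_apply]
    rw [← mul_assoc, ← mul_assoc, mul_comm k.2, mul_comm ((α c).1 k).2]
    simp
  by_cases hc : (∀ k, I k = I (delta _ (twist ε (prodPerm w α) k))) ∧
          (∀ k, k.2 * H k = (twist ε (prodPerm w α) k).2 *
            H (delta _ (twist ε (prodPerm w α) k)))
  · rw [if_pos hc, if_pos (hcond.2 hc), prod_sign_eq, ← hs0, mul_assoc,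
      ← Finset.prod_mul_distrib]
    congr 1
    refine Finset.prod_congr rfl fun c _ => ?_
    rw [mul_assoc, Finset.prod_filter]
    congr 1
    refine Finset.prod_congr rfl fun x _ => ?_
    have : η (inclInf _ (x, 1)) * η (inclInf _ (x, -1)) =
        H (((x : Fin n) : PtInf n), 1) * H (((x : Fin n) : PtInf n), -1) := by
      simp only [hη, flip_apply, inclInf_apply]
      rcases Int.units_eq_one_or (extSign ε ((x : Fin n) : PtInf n)) with h | h <;>
        simp [h, mul_comm]
    rw [this]
  · rw [if_neg hc, if_neg (fun h => hc (hcond.1 h)), mul_zero]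

/-- The cycle of `∞` in `#(α)/2` cancels against the extra 1 in `|J| = n + 1`, and the even shift `2
#(φ)` does not affect the sign of the power of `-2`. -/
theorem factor_eq (hN : N ≠ 0) (w : Fin n → Fin C) (ε : Fin n → ℤˣ) (φ ψ : Perm (PtInf n))
    (α : ∀ c, PM (colourClass w c)) :
    (2 : ℂ) ^ (-(((numCycles (double φ) / 2 : ℕ) : ℤ) - 1)) *
      (N : ℂ) ^ (-(((numCycles (double ψ) / 2 : ℕ) : ℤ) - 1)) *
      ((∏ c, (2 * (N : ℂ)) ^ (((numCycles (α c).1 / 2 : ℕ) : ℤ) - ((colourClass w c).card : ℤ))) *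
        (-1 : ℂ) ^ chi φ (twist ε (prodPerm w α))) =
    (-2 : ℂ) ^ (chi φ (twist ε (prodPerm w α)) - 2 * (numCycles φ : ℤ)) *
      (N : ℂ) ^ (chi ψ (twist ε (prodPerm w α)) - 2 * (numCycles ψ : ℤ)) *
      ((2 : ℂ) ^ (-(((numCycles (K φ (twist ε (prodPerm w α)))⁻¹ / 2 : ℕ) : ℤ) - 1)) *
        (N : ℂ) ^ (-(((numCycles (K ψ (twist ε (prodPerm w α)))⁻¹ / 2 : ℕ) : ℤ) - 1))) := by
  have hN' : (N : ℂ) ≠ 0 := Nat.cast_ne_zero.2 hN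
  have hd : ∀ β : Perm (PtInf n), numCycles (double β) / 2 = numCycles β := fun β => by
    rw [numCycles_double]; omega
  have hcard : ∑ c, ((colourClass w c).card : ℤ) = n := by
    have := Finset.card_eq_sum_card_fiberwise (s := Finset.univ) (t := Finset.univ) (f := w)
      fun _ _ => Finset.mem_univ _
    rw [Finset.card_univ, Fintype.card_fin] at this
    exact_mod_cast this.symm
  have hcardJ : (Fintype.card (PtInf n) : ℤ) = n + 1 := by
    have : Fintype.card (PtInf n) = n + 1 := by
      rw [show Fintype.card (PtInf n) = Fintype.card (Option (Fin n)) from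
        Fintype.card_congr (Equiv.refl _)]
      simp
    exact_mod_cast this
  have hprod : ∏ c, (2 * (N : ℂ)) ^ (((numCycles (α c).1 / 2 : ℕ) : ℤ) -
      ((colourClass w c).card : ℤ)) = (2 * (N : ℂ)) ^ ((∑ c, ((numCycles (α c).1 / 2 : ℕ) : ℤ)) - n) := by
    have h0 : (2 * (N : ℂ)) ≠ 0 := mul_ne_zero two_ne_zero hN'
    have h (z : Fin C → ℤ) (s : Finset (Fin C)) :
        ∏ c ∈ s, (2 * (N : ℂ)) ^ z c = (2 * (N : ℂ)) ^ ∑ c ∈ s, z c := by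
      induction s using Finset.induction_on with
      | empty => simp
      | insert c s hc ih => rw [Finset.prod_insert hc, Finset.sum_insert hc, zpow_add₀ h0, ih]
    rw [h, ← hcard, ← Finset.sum_sub_distrib]
  have hneg : ∀ m : ℤ, (-2 : ℂ) ^ (m - 2 * (numCycles φ : ℤ)) =
      (-1) ^ m * 2 ^ (m - 2 * (numCycles φ : ℤ)) := fun m => by
    rw [show (-2 : ℂ) = (-1) * 2 by norm_num, mul_zpow]
    congr 1
    rw [zpow_sub₀ (by norm_num), zpow_mul]
    norm_num
  rw [hprod, hneg, mul_zpow]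
  simp only [chi, hd, numCycles_inv, numCycles_twist_prodPerm_div_two, hcardJ]
  push_cast
  generalize (∑ c, ((numCycles (α c).1 : ℤ) / 2)) = s
  generalize ((numCycles (K φ (twist ε (prodPerm w α))) : ℤ) / 2) = κ
  generalize ((numCycles (K ψ (twist ε (prodPerm w α))) : ℤ) / 2) = κ'
  generalize (numCycles φ : ℤ) = p
  generalize (numCycles ψ : ℤ) = q
  generalize (-1 : ℂ) ^ (p + (1 + s) + κ - (n + 1)) = r
  have h2 : (2 : ℂ) ^ (-(p - 1)) * 2 ^ (s - n) =
      2 ^ (p + (1 + s) + κ - (n + 1) - 2 * p) * 2 ^ (-(κ - 1)) := by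
    rw [← zpow_add₀ two_ne_zero, ← zpow_add₀ two_ne_zero]
    congr 1; ring
  have h3 : (N : ℂ) ^ (-(q - 1)) * (N : ℂ) ^ (s - n) =
      (N : ℂ) ^ (q + (1 + s) + κ' - (n + 1) - 2 * q) * (N : ℂ) ^ (-(κ' - 1)) := by
    rw [← zpow_add₀ hN', ← zpow_add₀ hN']
    congr 1; ring
  linear_combination (r * ((N : ℂ) ^ (-(q - 1)) * (N : ℂ) ^ (s - n))) * h2 +
    r * (2 ^ (p + (1 + s) + κ - (n + 1) - 2 * p) * 2 ^ (-(κ - 1))) * h3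

end Moments

/-! ### Taking expectations in the label sum -/

section Expectation

variable {n N C : ℕ}

theorem apply_bot_eq {π : Perm (Signed (PtInf n))} (hπ : π (infPt n) = infPt n) {T : Type}
    {I : Signed (PtInf n) → T} (hI : ∀ k, I k = I (delta _ (π k))) : I (⊥, 1) = I (⊥, -1) := by
  have := hI (infPt n)
  rw [hπ] at this
  simpa using this

theorem sign_apply_bot_eq {π : Perm (Signed (PtInf n))} (hπ : π (infPt n) = infPt n)
    {H : Signed (PtInf n) → ℤˣ} (hH : ∀ k, k.2 * H k = (π k).2 * H (delta _ (π k))) :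
    H (⊥, 1) = H (⊥, -1) := by
  have := hH (infPt n)
  rw [hπ] at this
  simpa using this

open Classical in
-- For each labelling the `X` and `Y` factors are independent, so the expectation splits; the
-- expansion of the `X` factor is inserted and the sum over `α` moved outside.
theorem integral_reTrSum {Ω : Type*} [MeasurableSpace Ω] (μ : Measure Ω) [IsProbabilityMeasure μ]
    (X : Fin C → Fin n → Ω → QMat N) (Y : Fin n → Ω → QMat N) (w : Fin n → Fin C)
    (hXmeas : ∀ c k, Measurable (X c k))
    (hXindep : iIndepFun (fun c ω k => X c k ω) μ)
    (hXYindep : IndepFun (fun ω k => X (w k) k ω) (fun ω k => Y k ω) μ)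
    (f : ∀ (_ : Fin C) (I : Finset (Fin n)), PM I → ℂ)
    (hf : ∀ c I, HasMomentExpansion μ (X c) I (f c I))
    (hYint : ∀ (i j : Fin n → Fin N) (h h' : Fin n → ℤˣ),
      Integrable (fun ω => ∏ k, entry (Y k ω) (i k) (j k) (h k) (h' k)) μ)
    (φ ψ : Perm (PtInf n)) (ε : Fin n → ℤˣ) (a b : Fin N) (c d : ℤˣ) :
    Integrable (fun ω => reTrSum (double φ) (double ψ)
      (fun k => starPow (X (w k) k ω) (ε k) * Y k ω) a b c d) μ ∧
    ∫ ω, reTrSum (double φ) (double ψ)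
        (fun k => starPow (X (w k) k ω) (ε k) * Y k ω) a b c d ∂μ =
      ∑ α : ∀ c, PM (colourClass w c),
        (∏ c, ((2 * (N : ℂ)) ^ (((numCycles (α c).1 / 2 : ℕ) : ℤ) - ((colourClass w c).card : ℤ)) *
          f c (colourClass w c) (α c))) *
        ((-1) ^ chi φ (twist ε (prodPerm w α)) *
          ∫ ω, reTrSum (K φ (twist ε (prodPerm w α)))⁻¹ (K ψ (twist ε (prodPerm w α)))⁻¹
            (fun k => Y k ω) a b c d ∂μ) := by
  have hX := integral_prod_starPow μ X w hXmeas hXindep f hf ε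
  let x : (Signed (PtInf n) → Fin N) → (Signed (PtInf n) → ℤˣ) → (Fin n → QMat N) → ℂ :=
    fun I H A => ∏ k : Fin n, entry (starPow (A k) (ε k)) (I ((k : PtInf n), 1))
      (I ((k : PtInf n), -1)) (H ((k : PtInf n), 1)) (H ((k : PtInf n), -1))
  let y : (Signed (PtInf n) → Fin N) → (Signed (PtInf n) → ℤˣ) → (Fin n → QMat N) → ℂ :=
    fun I H A => ∏ k : Fin n, entry (A k) (I ((k : PtInf n), -1)) (I (ψ k, 1))
      (H ((k : PtInf n), -1)) (H (φ k, 1))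
  have hY : ∀ I H, Integrable (fun ω => y I H fun k => Y k ω) μ := fun I H => hYint _ _ _ _
  have hind : ∀ I H, IndepFun (fun ω => x I H fun k => X (w k) k ω)
      (fun ω => y I H fun k => Y k ω) μ := fun I H =>
    hXYindep.comp (φ := x I H) (ψ := y I H)
      (Finset.measurable_fun_prod _ fun k _ =>
        (measurable_starPow _ _ _ _ _).comp (measurable_pi_apply k))
      (Finset.measurable_fun_prod _ fun k _ =>
        (measurable_entry _ _ _ _).comp (measurable_pi_apply k))
  have hint : ∀ I : Signed (PtInf n) → Fin N, I (⊥, 1) = I (⊥, -1) →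
      ∀ H : Signed (PtInf n) → ℤˣ, H (⊥, 1) = H (⊥, -1) →
      Integrable (fun ω => (x I H fun k => X (w k) k ω) * y I H fun k => Y k ω) μ :=
    fun I hI H hH => (hind I H).integrable_mul (hX I H hI hH).1 (hY I H)
  have hα : ∀ α : ∀ c, PM (colourClass w c), (-1) ^ chi φ (twist ε (prodPerm w α)) *
      ∫ ω, reTrSum (K φ (twist ε (prodPerm w α)))⁻¹ (K ψ (twist ε (prodPerm w α)))⁻¹
        (fun k => Y k ω) a b c d ∂μ =
      ∑ I : Signed (PtInf n) → Fin N with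
          (∀ k, I k = I (delta _ (twist ε (prodPerm w α) k))) ∧ I (infPt n) = a ∧ I (ψ ⊥, 1) = b,
        ∑ H : Signed (PtInf n) → ℤˣ with
          (∀ k, k.2 * H k = (twist ε (prodPerm w α) k).2 *
            H (delta _ (twist ε (prodPerm w α) k))) ∧ H (infPt n) = c ∧ H (φ ⊥, 1) = d,
          (((selSign (fun j => extSign ε j * colourSign α j) H : ℤˣ) : ℤ) : ℂ) *
            ∫ ω, y I H fun k => Y k ω ∂μ := fun α => by
    have h := sum_label_eq (isPM_twist_prodPerm α ε) (twist_prodPerm_inf α ε)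
      (isSelection_twist ε (isSelection_prodPerm α)) φ ψ (N := N)
    rw [← integral_const_mul]
    simp only [← h]
    rw [integral_finsetSum _ fun I _ => integrable_finsetSum _ fun H _ => (hY I H).const_mul _]
    refine Finset.sum_congr rfl fun I _ => ?_
    rw [integral_finsetSum _ fun H _ => (hY I H).const_mul _]
    exact Finset.sum_congr rfl fun H _ => integral_const_mul _ _
  simp only [reTrSum_double_mul, hα]
  refine ⟨integrable_finsetSum _ fun I hI => integrable_finsetSum _ fun H hH =>
    hint I (Finset.mem_filter.1 hI).2.1 H (Finset.mem_filter.1 hH).2.1, ?_⟩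
  rw [integral_finsetSum _ fun I hI => integrable_finsetSum _ fun H hH =>
    hint I (Finset.mem_filter.1 hI).2.1 H (Finset.mem_filter.1 hH).2.1]
  have hterm : ∀ I : Signed (PtInf n) → Fin N, I (⊥, 1) = I (⊥, -1) →
      ∀ H : Signed (PtInf n) → ℤˣ, H (⊥, 1) = H (⊥, -1) →
      ∫ ω, (x I H fun k => X (w k) k ω) * (y I H fun k => Y k ω) ∂μ = _ := fun I hI H hH =>
    ((hind I H).integral_fun_mul_eq_mul_integral (hX I H hI hH).1.aestronglyMeasurable
      (hY I H).aestronglyMeasurable).trans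
      (congrArg (· * ∫ ω, y I H fun k => Y k ω ∂μ) (hX I H hI hH).2)
  refine (Finset.sum_congr rfl fun I hI => (integral_finsetSum _ fun H hH =>
    hint I (Finset.mem_filter.1 hI).2.1 H (Finset.mem_filter.1 hH).2.1).trans
      (Finset.sum_congr rfl fun H hH => (hterm I (Finset.mem_filter.1 hI).2.1 H
        (Finset.mem_filter.1 hH).2.1).trans (Finset.sum_mul _ _ _))).trans ?_
  simp only [Finset.sum_comm (s := Finset.filter _ _) (t := (Finset.univ :
    Finset (∀ c, PM (colourClass w c))))]
  refine Finset.sum_congr rfl fun α _ => ?_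
  have hb := twist_prodPerm_inf α ε
  rw [Finset.mul_sum]
  simp only [Finset.sum_filter]
  refine Finset.sum_congr rfl fun I _ => ?_
  -- Compatibility with `α` already implies equal labels at `±∞`, as `α` fixes them. The condition
  -- at infinity from the expansion of the traces is thus absorbed.
  by_cases hI : ∀ k, I k = I (delta _ (twist ε (prodPerm w α) k))
  · have hI' := apply_bot_eq hb hI
    by_cases hI2 : I (infPt n) = a ∧ I (ψ ⊥, 1) = b
    · rw [if_pos ⟨hI', hI2⟩, if_pos ⟨hI, hI2⟩, Finset.mul_sum]
      refine Finset.sum_congr rfl fun H _ => ?_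
      by_cases hH : ∀ k, k.2 * H k = (twist ε (prodPerm w α) k).2 *
          H (delta _ (twist ε (prodPerm w α) k))
      · have hH' := sign_apply_bot_eq hb hH
        by_cases hH2 : H (infPt n) = c ∧ H (φ ⊥, 1) = d
        · rw [if_pos ⟨hH', hH2⟩, if_pos ⟨hI, hH⟩, if_pos ⟨hH, hH2⟩]
          ring
        · rw [if_neg fun h => hH2 h.2, if_neg fun h => hH2 h.2, mul_zero]
      · rw [if_neg (c := _ ∧ H (infPt n) = c ∧ _) (fun h => hH h.1),
          if_neg (c := (∀ k, I k = _) ∧ _) (fun h => hH h.2), zero_mul, ite_self, mul_zero]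
    · rw [if_neg fun h => hI2 h.2, if_neg fun h => hI2 h.2]
  · rw [if_neg (c := (∀ k, I k = _) ∧ I (infPt n) = a ∧ _) (fun h => hI h.1)]
    have h0 : ∀ H : Signed (PtInf n) → ℤˣ, ¬ ((∀ k, I k = I (delta _ (twist ε (prodPerm w α) k))) ∧
      ∀ k, k.2 * H k = (twist ε (prodPerm w α) k).2 *
          H (delta _ (twist ε (prodPerm w α) k))) := fun H h => hI h.1
    simp only [if_neg (h0 _), zero_mul, ite_self, Finset.sum_const_zero]

end Expectation

end QuatExpansion

theorem mainTheorem10 {Ω : Type*} [MeasurableSpace Ω] (μ : Measure Ω) [IsProbabilityMeasure μ]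
    (n N C : ℕ)
    (X : Fin C → Fin n → Ω → QuatExpansion.QMat N) (Y : Fin n → Ω → QuatExpansion.QMat N)
    (w : Fin n → Fin C)
    (hXmeas : ∀ c k, Measurable (X c k)) (hYmeas : ∀ k, Measurable (Y k))
    (hXindep : iIndepFun (fun c ω k => X c k ω) μ)
    (hXYindep : IndepFun (fun ω k => X (w k) k ω) (fun ω k => Y k ω) μ)
    (f : ∀ (_ : Fin C) (I : Finset (Fin n)), QuatExpansion.PM I → ℂ)
    (hf : ∀ c I, QuatExpansion.HasMomentExpansion μ (X c) I (f c I))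
    (hYint : ∀ (i j : Fin n → Fin N) (h h' : Fin n → ℤˣ),
      Integrable (fun ω => ∏ k, QuatExpansion.entry (Y k ω) (i k) (j k) (h k) (h' k)) μ)
    (φRe φtr : Equiv.Perm (QuatExpansion.PtInf n)) (ε : Fin n → ℤˣ)
    (a b : Fin N) (c d : ℤˣ) :
    Integrable (fun ω => QuatExpansion.reTr (QuatExpansion.double φRe) (QuatExpansion.double φtr)
        (fun k => QuatExpansion.starPow (X (w k) k ω) (ε k) * Y k ω) a b c d) μ ∧
    ∫ ω, QuatExpansion.reTr (QuatExpansion.double φRe) (QuatExpansion.double φtr)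
        (fun k => QuatExpansion.starPow (X (w k) k ω) (ε k) * Y k ω) a b c d ∂μ =
      ∑ α : ∀ c, QuatExpansion.PM (QuatExpansion.colourClass w c),
        (-2 : ℂ) ^ (QuatExpansion.chi φRe (QuatExpansion.twist ε (QuatExpansion.prodPerm w α))
            - 2 * (QuatExpansion.numCycles φRe : ℤ)) *
        (N : ℂ) ^ (QuatExpansion.chi φtr (QuatExpansion.twist ε (QuatExpansion.prodPerm w α))
            - 2 * (QuatExpansion.numCycles φtr : ℤ)) *
        (∏ c, f c (QuatExpansion.colourClass w c) (α c)) *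
        ∫ ω, QuatExpansion.reTr
          (QuatExpansion.K φRe (QuatExpansion.twist ε (QuatExpansion.prodPerm w α)))⁻¹
          (QuatExpansion.K φtr (QuatExpansion.twist ε (QuatExpansion.prodPerm w α)))⁻¹
          (fun k => Y k ω) a b c d ∂μ := by
  -- The uncontracted index `a` shows that `N` is positive, which the laws for integer powers of `N`
  -- require.
  have hN : N ≠ 0 := fun h => (h ▸ a).elim0
  obtain ⟨h1, h2⟩ := QuatExpansion.integral_reTrSum μ X Y w hXmeas hXindep hXYindep f hf hYint
    φRe φtr ε a b c d
  simp only [QuatExpansion.reTr_eq]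
  refine ⟨h1.const_mul _, ?_⟩
  simp only [integral_const_mul]
  rw [h2, Finset.mul_sum]
  refine Finset.sum_congr rfl fun α _ => ?_
  have h3 := QuatExpansion.factor_eq hN w ε φRe φtr α
  rw [Finset.prod_mul_distrib]
  linear_combination ((∏ c, f c (QuatExpansion.colourClass w c) (α c)) *
    ∫ ω, QuatExpansion.reTrSum
      (QuatExpansion.K φRe (QuatExpansion.twist ε (QuatExpansion.prodPerm w α)))⁻¹
      (QuatExpansion.K φtr (QuatExpansion.twist ε (QuatExpansion.prodPerm w α)))⁻¹
      (fun k => Y k ω) a b c d ∂μ) * h3
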